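/- **Setting.** Let $D=(S,E,P_T,P_E,s^I,AP,L)$ be a labeled stochastic discrete event system: $S,E$ finite, $E$ partitioned into controllable and uncontrollable events, $\sum_{s'}P_T(s'|s,e)\in\{0,1\}$, and $e$ enabled at $s$ if this sum is $1$; assume that some event is enabled at every state. A control pattern at $s$ is a nonempty set $\xi$ of events enabled at $s$ that contains all uncontrollable events enabled at $s$; it is directed if it contains at most one controllable event. For a control pattern $\xi$ at $s$, $P_E(\cdot|s,\xi)$ is a probability distribution on $\xi$ with all weights positive, and $P(s'|s,\xi)=\sum_{e\in\xi}P_E(e|s,\xi)P_T(s'|s,e)$. Let $\varphi$ be an LTL formula over $AP$, $B$ a universal co-Büchi automaton over $2^{AP}$ with finite state set $X$ accepting exactly the words satisfying $\varphi$, $K\in\mathbb N_0$, and $\det(B,K)$ the determinization with states $F:X\to\{-1,\dots,K+1\}$, transitions $\Delta(F,\sigma)(x')=\max\{\min(K+1,F(x)+\mathbf 1[x'\in Acc]) : x'\in\delta(x,\sigma),F(x)\ne-1\}$ ($\max\emptyset=-1$) and accepting set $Acc_d=\{F:\exists x,\ F(x)>K\}$, assumed to be a sink set. The product $D^\otimes$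 has states $S^\otimes=\{(s,F)\}$, transition probabilities $P_T(s'|s,e)\mathbf 1[F'=\Delta(F,L(s))]$, event probabilities and control patterns of $D$, and $Acc^\otimes=\{(s,F):F\in Acc_d\}$. Write $\Xi_{dir}(s)$ for the set of directed control patterns at $s\in S^\otimes$. Let $r_n<0$, $\gamma,\gamma_{acc}\in(0,1)$; put $\mathcal R=(1-\gamma_{acc})r_n$, $\Gamma=\gamma_{acc}$ on $Acc^\otimes$ and $\mathcal R=0$, $\Gamma=\gamma$ elsewhere. Let $$Q^\ast(s,\xi)=\max_{SV}\ \mathbb E_{SV}\Big[\sum_{t\ge0}\mathcal R(s_{t+1})\prod_{k=0}^{t-1}\Gamma(s_{k+1})\,\Big|\,s_0=s,\xi_0=\xi\Big],$$ the maximum over directed controllers $SV$ (maps with $SV(s)\in\Xi_{dir}(s)$ for all $s\in S^\otimes$), where $\xi$ is applied first and $SV$ from then on. **Stage 1.** With a constant $\alpha\in(0,1)$, start from the table $Q(s,\xi)=r_n$ for $s\in Acc^\otimes$ and $Q(s,\xi)=0$ otherwise. For a table $Q$ let $W(Q)=\{s:\exists\xi\in\Xi_{dir}(s),\,Q(s,\xi)=0\}$.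 As long as $W(Q)\neq\emptyset$: at the current state $s\in W(Q)$ draw $\xi$ uniformly from $\{\xi\in\Xi_{dir}(s):Q(s,\xi)=0\}$ and observe $e\sim P_E(\cdot|s,\xi)$ and the next state $s'\sim P_T(\cdot|s,e)$. If $s'\in W(Q)$, keep $Q$ and continue from $s'$ (or end the episode). If $s'\notin W(Q)$, update $Q(s,\xi')\leftarrow(1-\alpha)Q(s,\xi')+\alpha\{\mathcal R(s')+\Gamma(s')\max_{\xi''\in\Xi_{dir}(s')}Q(s',\xi'')\}$ for $\xi'=\xi$ if $e$ is controllable, for all $\xi'\in\Xi_{dir}(s)$ if $e$ is uncontrollable, and end the episode. A new episode starts at any state of the current $W(Q)$. Let $W^\infty$ be the limit (intersection) of the decreasing sets $W(Q)$ along the run. Assume that with probability 1 every $s\in W^\infty$ is the current state infinitely often. **Stage 2.** Start with the (eventually constant) table learned in Stage 1, as $Q^0$, and a set $S_0\subseteq S^\otimes$ of allowed start states (for instance only the initial state, or all of $S^\otimes$). At update $k$, at the current state $s_k\notin W^\infty$ choose, possibly depending on the past, $\xi_k\in\Xi_{dir}(s_k)$ and a step size $\alpha_k\ge0$, observe $e_k\sim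 P_E(\cdot|s_k,\xi_k)$ and $s_k'\sim P_T(\cdot|s_k,e_k)$, and set $$Q^{k+1}(s_k,\xi_k)=(1-\alpha_k)Q^k(s_k,\xi_k)+\alpha_k\Big\{\mathcal R(s'_k)+\Gamma(s'_k)\max_{\xi'\in\Xi_{dir}(s'_k)}Q^k(s'_k,\xi')\Big\},$$ all other entries being unchanged. Then $s_{k+1}=s_k'$, unless $s'_k\in W^\infty$ or the episode is ended, in which case $s_{k+1}\in S_0$. Let $\mathcal T$ be the set of states outside $W^\infty$ that are reachable from $S_0\setminus W^\infty$ along transitions of positive probability under directed control patterns without entering $W^\infty$ (so $\mathcal T=S^\otimes\setminus W^\infty$ if $S_0=S^\otimes$). Assume that with probability 1, for all $s\in\mathcal T\setminus Acc^\otimes$ and $\xi\in\Xi_{dir}(s)$, $$\sum_{k:(s_k,\xi_k)=(s,\xi)}\alpha_k=\infty,\qquad\sum_{k:(s_k,\xi_k)=(s,\xi)}\alpha_k^2<\infty .$$ **Claim.** With probability 1: (i) $\lim_{k\to\infty}Q^k(s,\xi)=Q^\ast(s,\xi)$ for every $s\in\mathcal T\cup Acc^\otimes$ and every $\xi\in\Xi_{dir}(s)$;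 (ii) for every $s\in W^\infty$, $\lim_{k\to\infty}Q^k(s,\xi)=Q^\ast(s,\xi)$ for every $\xi\in\Xi_{dir}(s)$ with $Q^\ast(s,\xi)=0$, and $\lim_{k\to\infty}\max_{\xi\in\Xi_{dir}(s)}Q^k(s,\xi)=\max_{\xi\in\Xi_{dir}(s)}Q^\ast(s,\xi)$. -/

import Mathlib

open Filter Topology MeasureTheory ProbabilityTheory
open scoped Classical

noncomputable section

/-! ### Linear temporal logic and universal co-Büchi automata -/

/-- Formulas of linear temporal logic over the atomic propositions `AP`. -/
inductive LTL (AP : Type*) where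
  | top : LTL AP
  | atom : AP → LTL AP
  | conj : LTL AP → LTL AP → LTL AP
  | neg : LTL AP → LTL AP
  | nxt : LTL AP → LTL AP
  | untl : LTL AP → LTL AP → LTL AP

/-- Satisfaction of a formula by an infinite word over `2^AP`. -/
def LTL.Sat {AP : Type*} : LTL AP → (ℕ → Set AP) → Prop
  | .top, _ => True
  | .atom a, w => a ∈ w 0
  | .conj φ ψ, w => φ.Sat w ∧ ψ.Sat w
  | .neg φ, w => ¬ φ.Sat w
  | .nxt φ, w => φ.Sat (fun n => w (n + 1))
  | .untl φ ψ, w => ∃ j, ψ.Sat (fun n => w (n + j)) ∧ ∀ i < j, φ.Sat (fun n => w (n + i))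

/-- An ω-automaton with state set `X` and input alphabet `A`. -/
structure OmegaAutomaton (X A : Type*) where
  δ : X → A → Set X
  init : X
  acc : Set X

/-- The universal co-Büchi acceptance condition: every run on `w` visits every accepting state
only finitely often. -/
def OmegaAutomaton.CoBuchiAccepts {X A : Type*} (B : OmegaAutomaton X A) (w : ℕ → A) : Prop :=
  ∀ r : ℕ → X, r 0 = B.init → (∀ i, r (i + 1) ∈ B.δ (r i) (w i)) →
    ∀ x ∈ B.acc, {i | r i = x}.Finite

/-- States of the determinization of a `K`-co-Büchi automaton: counter functions
`X → {-1, 0, …, K + 1}`. The element `⊥` of `WithBot (Fin (K + 2))` plays the role of `-1`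
and the elements of `Fin (K + 2)` are the counter values `0, …, K + 1`. -/
abbrev Counters (X : Type*) (K : ℕ) : Type _ := X → WithBot (Fin (K + 2))

/-- The transition function of the determinization:
`Δ(F, σ)(x') = max {min (K + 1) (F x + (x' ∈ Acc)) | x' ∈ δ(x, σ), F x ≠ -1}`, `max ∅ = -1`
(a supremum over a finite set in a linear order with bottom; `WithBot.map` keeps `⊥ = -1`). -/
def OmegaAutomaton.detStep {X A : Type*} [Fintype X] (B : OmegaAutomaton X A) (K : ℕ)
    (F : Counters X K) (σ : A) : Counters X K := fun x' =>
  (Finset.univ.filter fun x => x' ∈ B.δ x σ).sup fun x =>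
    (F x).map fun n : Fin (K + 2) =>
      (⟨min (K + 1) (n.val + if x' ∈ B.acc then 1 else 0), by omega⟩ : Fin (K + 2))

/-- The accepting set of the determinization: some counter exceeds `K`. -/
def OmegaAutomaton.detAcc {X A : Type*} (_B : OmegaAutomaton X A) (K : ℕ) : Set (Counters X K) :=
  {F | ∃ x, F x = ((Fin.last (K + 1) : Fin (K + 2)) : WithBot (Fin (K + 2)))}

/-- The accepting set of the determinization has no outgoing transition. -/
def OmegaAutomaton.DetAccIsSink {X A : Type*} [Fintype X] (B : OmegaAutomaton X A) (K : ℕ) :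
    Prop :=
  ∀ F ∈ B.detAcc K, ∀ σ, B.detStep K F σ ∈ B.detAcc K

/-! ### Stochastic discrete event systems -/

/-- Control patterns at `s`: nonempty sets of enabled events (events `e` with
`∑ s', P_T(s' | s, e) = 1`) containing every enabled uncontrollable event. -/
def IsControlPattern {S E : Type*} [Fintype S] (ctrl : Set E) (PT : S → E → S → ℝ) (s : S)
    (ξ : Finset E) : Prop :=
  ξ.Nonempty ∧ (∀ e ∈ ξ, ∑ s', PT s e s' = 1) ∧
    ∀ e, ∑ s', PT s e s' = 1 → e ∉ ctrl → e ∈ ξ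

/-- A stochastic discrete event system with finite sets of states and events (without labels).
`PT s e s'` is `P_T(s' | s, e)` and `PE s ξ e` is `P_E(e | s, ξ)`. -/
structure SDES (S E : Type*) [Fintype S] where
  /-- the controllable events; all other events are uncontrollable -/
  ctrl : Set E
  PT : S → E → S → ℝ
  PE : S → Finset E → E → ℝ
  PT_nonneg : ∀ s e s', 0 ≤ PT s e s'
  PT_sum : ∀ s e, ∑ s', PT s e s' = 0 ∨ ∑ s', PT s e s' = 1
  PE_pos : ∀ s ξ, IsControlPattern ctrl PT s ξ → ∀ e ∈ ξ, 0 < PE s ξ e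
  PE_zero : ∀ s ξ, IsControlPattern ctrl PT s ξ → ∀ e, e ∉ ξ → PE s ξ e = 0
  PE_sum : ∀ s ξ, IsControlPattern ctrl PT s ξ → ∑ e ∈ ξ, PE s ξ e = 1

/-- A labeled SDES: an SDES with an initial state and a labeling by atomic propositions. -/
structure LabeledSDES (S E AP : Type*) [Fintype S] extends SDES S E where
  init : S
  label : S → Set AP

namespace SDES

/-- The event `e` is enabled at the state `s`. -/
def Enabled {S E : Type*} [Fintype S] (D : SDES S E) (s : S) (e : E) : Prop :=
  ∑ s', D.PT s e s' = 1

/-- The directed control patterns at `s`: control patterns with at most one controllable event. -/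
def dir {S E : Type*} [Fintype S] [Fintype E] (D : SDES S E) (s : S) : Finset (Finset E) :=
  Finset.univ.filter fun ξ =>
    IsControlPattern D.ctrl D.PT s ξ ∧ (ξ.filter fun e => e ∈ D.ctrl).card ≤ 1

/-- The controlled transition probability `P(s' | s, ξ)`. -/
def P {S E : Type*} [Fintype S] (D : SDES S E) (s : S) (ξ : Finset E) (s' : S) : ℝ :=
  ∑ e ∈ ξ, D.PE s ξ e * D.PT s e s'

theorem P_nonneg {S E : Type*} [Fintype S] (D : SDES S E) {s : S} {ξ : Finset E}
    (h : IsControlPattern D.ctrl D.PT s ξ) (s' : S) : 0 ≤ D.P s ξ s' :=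
  Finset.sum_nonneg fun e he => mul_nonneg (D.PE_pos s ξ h e he).le (D.PT_nonneg s e s')

theorem P_sum {S E : Type*} [Fintype S] (D : SDES S E) {s : S} {ξ : Finset E}
    (h : IsControlPattern D.ctrl D.PT s ξ) : ∑ s', D.P s ξ s' = 1 := by
  unfold P
  rw [Finset.sum_comm, ← D.PE_sum s ξ h]
  refine Finset.sum_congr rfl fun e he => ?_
  rw [← Finset.mul_sum, h.2.1 e he, mul_one]

theorem P_sum_ofReal {S E : Type*} [Fintype S] (D : SDES S E) {s : S} {ξ : Finset E}
    (h : IsControlPattern D.ctrl D.PT s ξ) : ∑ s', ENNReal.ofReal (D.P s ξ s') = 1 := by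
  rw [← ENNReal.ofReal_sum_of_nonneg fun s' _ => D.P_nonneg h s', D.P_sum h, ENNReal.ofReal_one]

/-- The law of the next state when `ξ` is applied at `s`. (If `ξ` is not a control pattern at `s`,
which never happens along the paths considered below, the state is kept.) -/
def nextLaw {S E : Type*} [Fintype S] (D : SDES S E) (s : S) (ξ : Finset E) : PMF S :=
  if h : IsControlPattern D.ctrl D.PT s ξ then
    PMF.ofFintype (fun s' => ENNReal.ofReal (D.P s ξ s')) (D.P_sum_ofReal h)
  else PMF.pure s

end SDES

/-! ### Product with the determinized automaton -/

/-- States of the product: pairs of a state of the SDES and a counter function. -/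
def ProdState (S X : Type*) (K : ℕ) : Type _ := S × Counters X K

instance instFintypeProdState (S X : Type*) (K : ℕ) [Fintype S] [Fintype X] :
    Fintype (ProdState S X K) :=
  letI : Fintype (WithBot (Fin (K + 2))) := inferInstanceAs (Fintype (Option (Fin (K + 2))))
  inferInstanceAs (Fintype (S × (X → WithBot (Fin (K + 2)))))

instance instMeasurableSpaceProdState (S X : Type*) (K : ℕ) : MeasurableSpace (ProdState S X K) := ⊤

instance instDiscreteProdState (S X : Type*) (K : ℕ) : DiscreteMeasurableSpace (ProdState S X K) :=
  ⟨fun _ => trivial⟩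

namespace LabeledSDES

/-- `P_T` of the product: the counter moves from `F` to `Δ(F, L(s))`. -/
def prodPT {S E AP X : Type*} [Fintype S] [Fintype X] (D : LabeledSDES S E AP)
    (B : OmegaAutomaton X (Set AP)) (K : ℕ) (q : ProdState S X K) (e : E) (q' : ProdState S X K) :
    ℝ :=
  if q'.2 = B.detStep K q.2 (D.label q.1) then D.PT q.1 e q'.1 else 0

theorem prodPT_sum {S E AP X : Type*} [Fintype S] [Fintype X] (D : LabeledSDES S E AP)
    (B : OmegaAutomaton X (Set AP)) (K : ℕ) (q : ProdState S X K) (e : E) :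
    ∑ q', D.prodPT B K q e q' = ∑ s', D.PT q.1 e s' := by
  refine (Finset.sum_of_injOn
    (fun s' => ((s', B.detStep K q.2 (D.label q.1)) : ProdState S X K)) ?_ ?_ ?_ ?_).symm
  · intro a _ b _ h
    exact congrArg Prod.fst h
  · intro a _
    exact Finset.mem_coe.2 (Finset.mem_univ _)
  · intro q' _ hq'
    refine if_neg fun h => hq' ⟨q'.1, by simp, ?_⟩
    exact Prod.ext rfl h.symm
  · intro s' _
    exact (if_pos rfl).symm

theorem prod_isControlPattern {S E AP X : Type*} [Fintype S] [Fintype X] (D : LabeledSDES S E AP)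
    (B : OmegaAutomaton X (Set AP)) (K : ℕ) (q : ProdState S X K) (ξ : Finset E)
    (h : IsControlPattern D.ctrl (D.prodPT B K) q ξ) : IsControlPattern D.ctrl D.PT q.1 ξ := by
  simpa only [IsControlPattern, prodPT_sum] using h

/-- The product SDES `D ⊗ det(B, K)`. -/
def prod {S E AP X : Type*} [Fintype S] [Fintype X] (D : LabeledSDES S E AP)
    (B : OmegaAutomaton X (Set AP)) (K : ℕ) : SDES (ProdState S X K) E where
  ctrl := D.ctrl
  PT := D.prodPT B K
  PE q ξ e := D.PE q.1 ξ e
  PT_nonneg q e q' := by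
    unfold prodPT
    split_ifs
    exacts [D.PT_nonneg _ _ _, le_rfl]
  PT_sum q e := by
    rw [prodPT_sum]
    exact D.PT_sum _ _
  PE_pos q ξ h := D.PE_pos q.1 ξ (D.prod_isControlPattern B K q ξ h)
  PE_zero q ξ h := D.PE_zero q.1 ξ (D.prod_isControlPattern B K q ξ h)
  PE_sum q ξ h := D.PE_sum q.1 ξ (D.prod_isControlPattern B K q ξ h)

/-- The accepting (i.e. bad) states of the product. -/
def prodAcc {S E AP X : Type*} [Fintype S] [Fintype X] (_D : LabeledSDES S E AP)
    (B : OmegaAutomaton X (Set AP)) (K : ℕ) : Set (ProdState S X K) :=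
  {q | q.2 ∈ B.detAcc K}

end LabeledSDES

/-! ### Rewards, expected returns and the optimal state-DCP value function -/

/-- The parameters of the reward function and of the state-dependent discount factor. -/
structure RewardParams where
  γ : ℝ
  γacc : ℝ
  rn : ℝ
  γ_mem : γ ∈ Set.Ioo (0 : ℝ) 1
  γacc_mem : γacc ∈ Set.Ioo (0 : ℝ) 1
  rn_neg : rn < 0

/-- The reward function. -/
def RewardParams.reward {T : Type*} (p : RewardParams) (acc : Set T) (s : T) : ℝ :=
  if s ∈ acc then (1 - p.γacc) * p.rn else 0

/-- The discount factor function. -/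
def RewardParams.discount {T : Type*} (p : RewardParams) (acc : Set T) (s : T) : ℝ :=
  if s ∈ acc then p.γacc else p.γ

/-- The return `∑_{t ≥ 0} R(s_{t+1}) ∏_{k < t} Γ(s_{k+1})` of a path (an absolutely convergent
series, as rewards are bounded and the discount factors are bounded by a number below one). -/
def RewardParams.pathReturn {T : Type*} (p : RewardParams) (acc : Set T) (ρ : ℕ → T) : ℝ :=
  ∑' t, p.reward acc (ρ (t + 1)) * ∏ k ∈ Finset.range t, p.discount acc (ρ (k + 1))

namespace SDES

/-- A directed controller: a choice of a directed control pattern at every state. -/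
def DirectedController {S E : Type*} [Fintype S] [Fintype E] (D : SDES S E) : Type _ :=
  {SV : S → Finset E // ∀ s, SV s ∈ D.dir s}

/-- The transition kernels of the state process which applies `ξ` at time `0` and follows `SV`
from time `1` on. -/
def stepKernel {S E : Type*} [Fintype S] [MeasurableSpace S] [DiscreteMeasurableSpace S]
    (D : SDES S E) (SV : S → Finset E) (ξ : Finset E) (n : ℕ) :
    Kernel ((i : Finset.Iic n) → S) S :=
  Kernel.ofFunOfCountable fun h =>
    (D.nextLaw (h ⟨n, Finset.mem_Iic.2 le_rfl⟩)
      (if n = 0 then ξ else SV (h ⟨n, Finset.mem_Iic.2 le_rfl⟩))).toMeasure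

instance instMarkovStepKernel {S E : Type*} [Fintype S] [MeasurableSpace S]
    [DiscreteMeasurableSpace S] (D : SDES S E) (SV : S → Finset E) (ξ : Finset E) (n : ℕ) :
    IsMarkovKernel (D.stepKernel SV ξ n) :=
  ⟨fun _ => PMF.toMeasure.isProbabilityMeasure _⟩

/-- The law of the infinite state path that starts at `s`, applies `ξ` first and then follows
`SV`. -/
def pathLaw {S E : Type*} [Fintype S] [MeasurableSpace S] [DiscreteMeasurableSpace S]
    (D : SDES S E) (SV : S → Finset E) (s : S) (ξ : Finset E) : Measure (ℕ → S) :=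
  Kernel.traj (X := fun _ => S) (D.stepKernel SV ξ) 0 fun _ => s

/-- The state-DCP value function of a directed controller: the expected return from `s` when `ξ` is
applied first. -/
def QValue {S E : Type*} [Fintype S] [Fintype E] [MeasurableSpace S] [DiscreteMeasurableSpace S]
    (D : SDES S E) (acc : Set S) (p : RewardParams) (SV : D.DirectedController) (s : S)
    (ξ : Finset E) : ℝ :=
  ∫ ρ, p.pathReturn acc ρ ∂(D.pathLaw SV.1 s ξ)

/-- The optimal state-DCP value function `Q*`: the maximum over the (finitely many) directed
controllers. -/
def QStar {S E : Type*} [Fintype S] [Fintype E] [MeasurableSpace S] [DiscreteMeasurableSpace S]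
    (D : SDES S E) (acc : Set S) (p : RewardParams) (s : S) (ξ : Finset E) : ℝ :=
  ⨆ SV : D.DirectedController, D.QValue acc p SV s ξ

/-- The maximum of `Q(s, ·)` over the (finite) set of directed control patterns at `s`. -/
def maxDir {S E : Type*} [Fintype S] [Fintype E] (D : SDES S E) (Q : S → Finset E → ℝ) (s : S) :
    ℝ :=
  sSup (Q s '' (D.dir s : Set (Finset E)))

/-! ### The two-stage Q-learning -/

/-- The directed control patterns `ξ` at `s` with `Q(s, ξ) = 0`; the pairs `(s, ξ)` form the
estimated winning pair set of the table `Q`. -/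
def zeroDir {S E : Type*} [Fintype S] [Fintype E] (D : SDES S E) (Q : S → Finset E → ℝ) (s : S) :
    Finset (Finset E) :=
  (D.dir s).filter fun ξ => Q s ξ = 0

/-- The estimated winning region of a table `Q`. -/
def estWin {S E : Type*} [Fintype S] [Fintype E] (D : SDES S E) (Q : S → Finset E → ℝ) : Set S :=
  {s | (D.zeroDir Q s).Nonempty}

/-- The updated value
`(1 - α) Q(s, ξ) + α (R(s') + Γ(s') max_{ξ'} Q(s', ξ'))` after observing the next state `s'`. -/
def tdValue {S E : Type*} [Fintype S] [Fintype E] (D : SDES S E) (acc : Set S) (p : RewardParams)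
    (α : ℝ) (Q : S → Finset E → ℝ) (s : S) (ξ : Finset E) (s' : S) : ℝ :=
  (1 - α) * Q s ξ + α * (p.reward acc s' + p.discount acc s' * D.maxDir Q s')

/-- The table update of Stage 1 when the estimated winning region is left from `s` under `ξ` by the
event `e` to `s'`: if `e` is uncontrollable, all directed control patterns at `s` are updated,
otherwise only `ξ`. -/
def updateOne {S E : Type*} [Fintype S] [Fintype E] (D : SDES S E) (acc : Set S) (p : RewardParams)
    (α : ℝ) (Q : S → Finset E → ℝ) (s : S) (ξ : Finset E) (e : E) (s' : S) : S → Finset E → ℝ :=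
  fun s₁ ξ₁ =>
    if s₁ = s ∧ ξ₁ ∈ D.dir s ∧ (e ∉ D.ctrl ∨ ξ₁ = ξ) then D.tdValue acc p α Q s ξ₁ s'
    else Q s₁ ξ₁

/-- The table update of Stage 2. -/
def updateTwo {S E : Type*} [Fintype S] [Fintype E] (D : SDES S E) (acc : Set S) (p : RewardParams)
    (α : ℝ) (Q : S → Finset E → ℝ) (s : S) (ξ : Finset E) (s' : S) : S → Finset E → ℝ :=
  fun s₁ ξ₁ => if s₁ = s ∧ ξ₁ = ξ then D.tdValue acc p α Q s ξ s' else Q s₁ ξ₁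

/-- A run of Stage 1 (learning of the winning region) with constant learning ratio `α`.
Time `n` counts interactions with the system; `Q n`, `state n` are the table and the state before
interaction `n`, in which `pattern n` is chosen, `event n` occurs and the state `succ n` is
observed. `ℱ n` is the information available before `pattern n` is drawn. The run is over, and the
table is kept, once the estimated winning region is empty. Episodes may (but need not) also be
ended before the estimated winning region is left: `cut n ω` says that this is done after
interaction `n`. -/
structure StageOneRun {S E Ω : Type*} [Fintype S] [Fintype E] [mΩ : MeasurableSpace Ω]
    (D : SDES S E) (acc : Set S) (p : RewardParams) (α : ℝ) (μ : Measure Ω) where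
  ℱ : Filtration ℕ mΩ
  Q : ℕ → Ω → S → Finset E → ℝ
  state : ℕ → Ω → S
  pattern : ℕ → Ω → Finset E
  event : ℕ → Ω → E
  succ : ℕ → Ω → S
  cut : ℕ → Ω → Prop
  meas_Q : ∀ n s ξ, Measurable[ℱ n] fun ω => Q n ω s ξ
  meas_state : ∀ n s, MeasurableSet[ℱ n] {ω | state n ω = s}
  meas_obs : ∀ n ξ e s',
    MeasurableSet[ℱ (n + 1)] {ω | pattern n ω = ξ ∧ event n ω = e ∧ succ n ω = s'}
  /-- The table starts with `0` at safe states and with `rn` at bad states. -/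
  init : ∀ᵐ ω ∂μ, ∀ s, ∀ ξ ∈ D.dir s, Q 0 ω s ξ = if s ∈ acc then p.rn else 0
  /-- The current state always lies in the current estimated winning region; in particular every
  episode starts there. -/
  state_mem : ∀ n, ∀ᵐ ω ∂μ, (D.estWin (Q n ω)).Nonempty → state n ω ∈ D.estWin (Q n ω)
  /-- `pattern n` is uniformly distributed on the directed control patterns of value zero at the
  current state, and `event n` and `succ n` follow the dynamics of the system. -/
  law : ∀ n ξ e s', ∀ᵐ ω ∂μ, (D.estWin (Q n ω)).Nonempty →
    (μ[({ω | pattern n ω = ξ ∧ event n ω = e ∧ succ n ω = s'}.indicator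
        fun _ => (1 : ℝ)) | ℱ n]) ω =
      if ξ ∈ D.zeroDir (Q n ω) (state n ω) then
        ((D.zeroDir (Q n ω) (state n ω)).card : ℝ)⁻¹ *
          (D.PE (state n ω) ξ e * D.PT (state n ω) e s')
      else 0
  /-- As long as the estimated winning region is not left, the table is kept and (unless the episode
  is cut) the episode goes on from the observed state. -/
  stay : ∀ n, ∀ᵐ ω ∂μ, succ n ω ∈ D.estWin (Q n ω) →
    Q (n + 1) ω = Q n ω ∧ (¬ cut n ω → state (n + 1) ω = succ n ω)
  /-- When the estimated winning region is left, the table is updated. -/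
  leave : ∀ n, ∀ᵐ ω ∂μ, (D.estWin (Q n ω)).Nonempty → succ n ω ∉ D.estWin (Q n ω) →
    Q (n + 1) ω = D.updateOne acc p α (Q n ω) (state n ω) (pattern n ω) (event n ω) (succ n ω)
  halt : ∀ n, ∀ᵐ ω ∂μ, ¬ (D.estWin (Q n ω)).Nonempty → Q (n + 1) ω = Q n ω

/-- The learned winning region `W^∞`, the limit of the decreasing sequence of estimated winning
regions. -/
def StageOneRun.learnedWin {S E Ω : Type*} [Fintype S] [Fintype E] [MeasurableSpace Ω]
    {D : SDES S E} {acc : Set S} {p : RewardParams} {α : ℝ} {μ : Measure Ω}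
    (R : D.StageOneRun acc p α μ) (ω : Ω) : Set S :=
  ⋂ n, D.estWin (R.Q n ω)

/-- A run of Stage 2 after the Stage 1 run `R`, with episodes starting in `S₀`.
Time `n` counts updates; in update `n` the directed control pattern `pattern n` is applied at
`state n`, `event n` occurs, `succ n` is observed and the entry `(state n, pattern n)` of the table
is updated with step size `α n`. `ℱ n` is the information available before `event n` occurs; the
choice of patterns and step sizes may depend on the past in any way. An episode ends when the
learned winning region is entered; it may (but need not) also be ended earlier: `cut n ω` says that
this is done after update `n`. -/
structure StageTwoRun {S E Ω : Type*} [Fintype S] [Fintype E] [mΩ : MeasurableSpace Ω]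
    {D : SDES S E} {acc : Set S} {p : RewardParams} {α₁ : ℝ} {μ : Measure Ω}
    (R : D.StageOneRun acc p α₁ μ) (S₀ : Set S) where
  ℱ : Filtration ℕ mΩ
  Q : ℕ → Ω → S → Finset E → ℝ
  α : ℕ → Ω → ℝ
  state : ℕ → Ω → S
  pattern : ℕ → Ω → Finset E
  event : ℕ → Ω → E
  succ : ℕ → Ω → S
  cut : ℕ → Ω → Prop
  meas_Q : ∀ n s ξ, Measurable[ℱ n] fun ω => Q n ω s ξ
  meas_α : ∀ n, Measurable[ℱ n] (α n)
  meas_state : ∀ n s, MeasurableSet[ℱ n] {ω | state n ω = s}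
  meas_pattern : ∀ n ξ, MeasurableSet[ℱ n] {ω | pattern n ω = ξ}
  meas_obs : ∀ n e s', MeasurableSet[ℱ (n + 1)] {ω | event n ω = e ∧ succ n ω = s'}
  α_nonneg : ∀ n ω, 0 ≤ α n ω
  /-- Stage 2 starts with the table learned by Stage 1. -/
  init : ∀ᵐ ω ∂μ, ∀ s, ∀ ξ ∈ D.dir s,
    Tendsto (fun n => R.Q n ω s ξ) atTop (𝓝 (Q 0 ω s ξ))
  start : ∀ᵐ ω ∂μ, state 0 ω ∈ S₀
  /-- Updates are made only at states outside the learned winning region. -/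
  state_notMem : ∀ n, ∀ᵐ ω ∂μ, state n ω ∉ R.learnedWin ω
  pattern_mem : ∀ n, ∀ᵐ ω ∂μ, pattern n ω ∈ D.dir (state n ω)
  /-- `event n` and `succ n` follow the dynamics of the system. -/
  law : ∀ n e s',
    μ[({ω | event n ω = e ∧ succ n ω = s'}.indicator fun _ => (1 : ℝ)) | ℱ n] =ᵐ[μ]
      fun ω => D.PE (state n ω) (pattern n ω) e * D.PT (state n ω) e s'
  update : ∀ n, ∀ᵐ ω ∂μ,
    Q (n + 1) ω = D.updateTwo acc p (α n ω) (Q n ω) (state n ω) (pattern n ω) (succ n ω)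
  carryOn : ∀ n, ∀ᵐ ω ∂μ, succ n ω ∉ R.learnedWin ω → ¬ cut n ω → state (n + 1) ω = succ n ω
  restart : ∀ n, ∀ᵐ ω ∂μ, succ n ω ∈ R.learnedWin ω ∨ cut n ω → state (n + 1) ω ∈ S₀

/-- The states outside `W` that can be reached from `S₀` by directed control patterns along paths
that avoid `W`. -/
inductive ReachOutside {S E : Type*} [Fintype S] [Fintype E] (D : SDES S E) (W S₀ : Set S) :
    S → Prop
  | base (s : S) : s ∈ S₀ → s ∉ W → ReachOutside D W S₀ s
  | step (s s' : S) (ξ : Finset E) : ReachOutside D W S₀ s → ξ ∈ D.dir s → 0 < D.P s ξ s' →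
      s' ∉ W → ReachOutside D W S₀ s'

end SDES

end

/-!
The optimal values solve the Bellman equation `Q*(s, ξ) = ∑ x, P(x | s, ξ) (R(x) + Γ(x) V*(x))`,
where `V*(x)` is the maximum of `Q*(x, ·)` over the directed control patterns
(`SDES.QStar_eq_backup`). Indeed, the Bellman operator is a contraction, with a factor below one
that bounds both discount factors. Along a path, the return up to time `n`, completed by the
discounted value of the state at time `n` under the fixed point of this operator, has
nonincreasing expectation from time `1` on, and constant expectation under the greedy controller
(`SDES.integral_truncReturn_succ`). It follows that `Q*` is nonpositive, equals `rn` on the bad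
states, which form a sink, and is negative as soon as a state of negative value can be reached in
one step.

**Stage 1.** An update of the first stage is made when a state without zero entries is observed;
as every updated pair leads to this state with positive probability, entries become negative only
where `Q*` is negative (`SDES.IsSound.updateOne`). Each update removes a zero of the table, so the
table is finally constant. Since every remaining state is visited infinitely often, Lévy's
conditional Borel–Cantelli lemma shows that each remaining pair of value zero is drawn infinitely
often with each of its outcomes. Hence these pairs never leave the learned winning region, which
is therefore safe, and `Q*` vanishes on them (`SDES.StageOneRun.ae_learned`). So the table of
Stage 1 has exactly the zeros of `Q*`, and the learned winning region is almost surely a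
deterministic set.

**Stage 2.** The entries at the winning states are never changed, and those at the bad states keep
the value `rn`, so the targets see the correct values there. The other reachable entries follow an
asynchronous stochastic approximation of the Bellman equation. The difference of an observed
target and its conditional mean is a combination of the centred indicators of the possible next
states, with weights known before the observation. Sums of such terms converge almost surely where
the squared weights are summable (`ae_tendsto_sum_of_summable_sq`, by martingale convergence after
a cut-off). The rest of the argument concerns a single path: once the step sizes are below one,
the entries stay bounded (`exists_bound_of_averaging`), so the noise sums converge; and adding the
tail of the noise sum to the error of an entry leaves a plain averaging recursion. It shows that
an asymptotic bound `c` of all errors improves to `β * c + ε`, hence the errors vanish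
(`tendsto_zero_of_asynchronous_contraction`).
-/

noncomputable section

/-! ### The Bellman optimality equation -/

namespace RewardParams

/-- The larger of the two discount factors, the modulus of contraction of the Bellman operator. -/
def maxDiscount (p : RewardParams) : ℝ := max p.γ p.γacc

theorem maxDiscount_pos (p : RewardParams) : 0 < p.maxDiscount :=
  lt_max_of_lt_left p.γ_mem.1

theorem maxDiscount_lt_one (p : RewardParams) : p.maxDiscount < 1 :=
  max_lt p.γ_mem.2 p.γacc_mem.2

theorem discount_pos {T : Type*} (p : RewardParams) (acc : Set T) (x : T) :
    0 < p.discount acc x := by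
  unfold discount
  split_ifs
  exacts [p.γacc_mem.1, p.γ_mem.1]

theorem discount_le {T : Type*} (p : RewardParams) (acc : Set T) (x : T) :
    p.discount acc x ≤ p.maxDiscount := by
  unfold discount maxDiscount
  split_ifs
  exacts [le_max_right _ _, le_max_left _ _]

theorem reward_nonpos {T : Type*} (p : RewardParams) (acc : Set T) (x : T) :
    p.reward acc x ≤ 0 := by
  unfold reward
  split_ifs
  · exact mul_nonpos_of_nonneg_of_nonpos (sub_nonneg.2 p.γacc_mem.2.le) p.rn_neg.le
  · exact le_rfl

theorem abs_reward_le {T : Type*} (p : RewardParams) (acc : Set T) (x : T) :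
    |p.reward acc x| ≤ |p.rn| := by
  unfold reward
  split_ifs
  · rw [abs_mul, abs_of_pos (sub_pos.2 p.γacc_mem.2)]
    have := p.γacc_mem.1
    have := abs_nonneg p.rn
    nlinarith
  · simp

theorem prod_discount_nonneg {T : Type*} (p : RewardParams) (acc : Set T) (ρ : ℕ → T) (n : ℕ) :
    0 ≤ ∏ k ∈ Finset.range n, p.discount acc (ρ (k + 1)) :=
  Finset.prod_nonneg fun _ _ => (p.discount_pos acc _).le

theorem prod_discount_le {T : Type*} (p : RewardParams) (acc : Set T) (ρ : ℕ → T) (n : ℕ) :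
    ∏ k ∈ Finset.range n, p.discount acc (ρ (k + 1)) ≤ p.maxDiscount ^ n := by
  calc _ ≤ ∏ _k ∈ Finset.range n, p.maxDiscount :=
        Finset.prod_le_prod (fun _ _ => (p.discount_pos acc _).le) fun _ _ => p.discount_le acc _
    _ = _ := by simp

theorem summable_pathReturn {T : Type*} (p : RewardParams) (acc : Set T) (ρ : ℕ → T) :
    Summable fun t =>
      p.reward acc (ρ (t + 1)) * ∏ k ∈ Finset.range t, p.discount acc (ρ (k + 1)) := by
  refine Summable.of_norm_bounded (g := fun t => |p.rn| * p.maxDiscount ^ t)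
    ((summable_geometric_of_lt_one p.maxDiscount_pos.le p.maxDiscount_lt_one).mul_left _) ?_
  intro t
  rw [Real.norm_eq_abs, abs_mul, abs_of_nonneg (p.prod_discount_nonneg acc ρ t)]
  exact mul_le_mul (p.abs_reward_le acc _) (p.prod_discount_le acc ρ t)
    (p.prod_discount_nonneg acc ρ t) (abs_nonneg _)

end RewardParams

/-- A family of numbers which is multiplied by a factor `β < 1` in terms of any of its nonnegative
upper bounds is nonpositive. -/
theorem nonpos_of_contraction {T : Type*} [Finite T] {A : Set T} {d : T → ℝ} {β : ℝ} (hβ : β < 1)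
    (h : ∀ c, 0 ≤ c → (∀ x ∈ A, d x ≤ c) → ∀ s ∈ A, d s ≤ β * c) : ∀ s ∈ A, d s ≤ 0 := by
  intro s hs
  -- The largest value bounds all values, so the hypothesis applies to it.
  obtain ⟨m, hm, hmax⟩ := (Set.toFinite A).exists_maximalFor d A ⟨s, hs⟩
  have hmax' : ∀ x ∈ A, d x ≤ d m := fun x hx => by
    rcases le_total (d x) (d m) with h | h
    exacts [h, hmax hx h]
  by_contra! hpos
  have h0 : 0 < d m := hpos.trans_le (hmax' s hs)
  have := h (d m) h0.le hmax' m hm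
  nlinarith

namespace SDES

variable {S E : Type*} [Fintype S] [Fintype E]

theorem isControlPattern_of_mem_dir {D : SDES S E} {s : S} {ξ : Finset E} (h : ξ ∈ D.dir s) :
    IsControlPattern D.ctrl D.PT s ξ :=
  (Finset.mem_filter.1 h).2.1

theorem le_maxDir (D : SDES S E) (Q : S → Finset E → ℝ) {s : S} {ξ : Finset E}
    (h : ξ ∈ D.dir s) : Q s ξ ≤ D.maxDir Q s :=
  le_csSup ((D.dir s).finite_toSet.image _).bddAbove ⟨ξ, h, rfl⟩

theorem exists_maxDir_eq (D : SDES S E) (Q : S → Finset E → ℝ) {s : S} (h : (D.dir s).Nonempty) :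
    ∃ ξ ∈ D.dir s, D.maxDir Q s = Q s ξ := by
  obtain ⟨ξ, hξ, h⟩ := Set.Nonempty.csSup_mem (h.to_set.image (Q s))
    ((D.dir s).finite_toSet.image _)
  exact ⟨ξ, hξ, h.symm⟩

theorem maxDir_le (D : SDES S E) (Q : S → Finset E → ℝ) {s : S} (h : (D.dir s).Nonempty) {c : ℝ}
    (hc : ∀ ξ ∈ D.dir s, Q s ξ ≤ c) : D.maxDir Q s ≤ c := by
  obtain ⟨ξ, hξ, h⟩ := D.exists_maxDir_eq Q h
  exact h ▸ hc ξ hξ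

theorem maxDir_congr (D : SDES S E) {Q Q' : S → Finset E → ℝ} {s : S}
    (h : ∀ ξ ∈ D.dir s, Q s ξ = Q' s ξ) : D.maxDir Q s = D.maxDir Q' s := by
  unfold maxDir
  rw [Set.image_congr h]

theorem abs_maxDir_sub_le (D : SDES S E) {Q Q' : S → Finset E → ℝ} {s : S}
    (hne : (D.dir s).Nonempty) {c : ℝ} (h : ∀ ξ ∈ D.dir s, |Q s ξ - Q' s ξ| ≤ c) :
    |D.maxDir Q s - D.maxDir Q' s| ≤ c := by
  rw [abs_sub_le_iff, sub_le_iff_le_add, sub_le_iff_le_add]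
  constructor
  · refine D.maxDir_le Q hne fun ξ hξ => ?_
    have := (abs_sub_le_iff.1 (h ξ hξ)).1
    have := D.le_maxDir Q' hξ
    linarith
  · refine D.maxDir_le Q' hne fun ξ hξ => ?_
    have := (abs_sub_le_iff.1 (h ξ hξ)).2
    have := D.le_maxDir Q hξ
    linarith

/-- The expected one-step target `∑ x, P(x | s, ξ) (R(x) + Γ(x) v(x))` of the state values `v`. -/
def backup (D : SDES S E) (acc : Set S) (p : RewardParams) (v : S → ℝ) (s : S) (ξ : Finset E) :
    ℝ :=
  ∑ x, D.P s ξ x * (p.reward acc x + p.discount acc x * v x)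

/-- The one-step target is a contraction in the values of the possible successor states. -/
theorem abs_backup_sub_le (D : SDES S E) (acc : Set S) (p : RewardParams) {v w : S → ℝ} {s : S}
    {ξ : Finset E} (hξ : ξ ∈ D.dir s) {c : ℝ}
    (h : ∀ x, 0 < D.P s ξ x → |v x - w x| ≤ c) :
    |D.backup acc p v s ξ - D.backup acc p w s ξ| ≤ p.maxDiscount * c := by
  have hP := isControlPattern_of_mem_dir hξ
  unfold backup
  rw [← Finset.sum_sub_distrib]
  calc _ ≤ ∑ x, |D.P s ξ x * (p.reward acc x + p.discount acc x * v x) -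
        D.P s ξ x * (p.reward acc x + p.discount acc x * w x)| := Finset.abs_sum_le_sum_abs _ _
    _ ≤ ∑ x, D.P s ξ x * (p.maxDiscount * c) := by
        refine Finset.sum_le_sum fun x _ => ?_
        have e : D.P s ξ x * (p.reward acc x + p.discount acc x * v x) -
          D.P s ξ x * (p.reward acc x + p.discount acc x * w x) =
          D.P s ξ x * (p.discount acc x * (v x - w x)) := by ring
        rw [e, abs_mul, abs_mul, abs_of_nonneg (D.P_nonneg hP x),
          abs_of_pos (p.discount_pos acc x)]
        rcases (D.P_nonneg hP x).eq_or_lt with h0 | h0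
        · simp [← h0]
        · exact mul_le_mul_of_nonneg_left (mul_le_mul (p.discount_le acc x) (h x h0)
            (abs_nonneg _) p.maxDiscount_pos.le) h0.le
    _ = _ := by rw [← Finset.sum_mul, D.P_sum hP, one_mul]

theorem exists_bellman_fixedPoint (D : SDES S E) (acc : Set S) (p : RewardParams)
    (hne : ∀ s, (D.dir s).Nonempty) :
    ∃ v : S → ℝ, ∀ s, v s = D.maxDir (D.backup acc p v) s := by
  let T : (S → ℝ) → S → ℝ := fun v s => D.maxDir (D.backup acc p v) s
  have hT : ContractingWith ⟨p.maxDiscount, p.maxDiscount_pos.le⟩ T := by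
    refine ⟨by exact_mod_cast p.maxDiscount_lt_one, LipschitzWith.of_dist_le_mul fun v w => ?_⟩
    refine (dist_pi_le_iff (mul_nonneg p.maxDiscount_pos.le dist_nonneg)).2 fun s => ?_
    rw [Real.dist_eq]
    refine D.abs_maxDir_sub_le (hne s) fun ξ hξ => D.abs_backup_sub_le acc p hξ fun x _ => ?_
    rw [← Real.dist_eq]
    exact dist_le_pi_dist v w x
  exact ⟨hT.fixedPoint, fun s => (congrFun hT.fixedPoint_isFixedPt s).symm⟩

/-! ### The optimal value function solves the Bellman optimality equation -/

section Verification

variable [MeasurableSpace S] [DiscreteMeasurableSpace S]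

theorem integral_nextLaw (D : SDES S E) {s : S} {ξ : Finset E} (hξ : ξ ∈ D.dir s) (f : S → ℝ) :
    ∫ x, f x ∂(D.nextLaw s ξ).toMeasure = ∑ x, D.P s ξ x * f x := by
  have hP := isControlPattern_of_mem_dir hξ
  rw [PMF.integral_eq_sum]
  refine Finset.sum_congr rfl fun x _ => ?_
  rw [nextLaw, dif_pos hP, PMF.ofFintype_apply, ENNReal.toReal_ofReal (D.P_nonneg hP x),
    smul_eq_mul]

instance isProbabilityMeasure_pathLaw (D : SDES S E) (SV : S → Finset E) (s : S) (ξ : Finset E) :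
    IsProbabilityMeasure (D.pathLaw SV s ξ) := by
  unfold pathLaw
  infer_instance

omit [Fintype E] in
theorem integrable_comp_frestrictLe (D : SDES S E) (SV : S → Finset E) (s : S) (ξ : Finset E)
    (n : ℕ) (g : ((i : Finset.Iic n) → S) → ℝ) :
    Integrable (fun ρ : ℕ → S => g (Preorder.frestrictLe (π := fun _ => S) n ρ))
      (D.pathLaw SV s ξ) := by
  have hm : Measurable (Preorder.frestrictLe (π := fun _ : ℕ => S) n) :=
    Preorder.measurable_frestrictLe n
  exact Integrable.comp_measurable (f := Preorder.frestrictLe (π := fun _ => S) n)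
    (Integrable.of_finite (f := g)) hm

/-- The Markov property of the path law at one time. -/
theorem integral_pathLaw_succ (D : SDES S E) (SV : S → Finset E) (hSV : ∀ s, SV s ∈ D.dir s)
    (s : S) (ξ : Finset E) {n : ℕ} (hn : n ≠ 0) (g : ((i : Finset.Iic n) → S) → ℝ) (f : S → ℝ) :
    ∫ ρ, g (Preorder.frestrictLe (π := fun _ => S) n ρ) * f (ρ (n + 1)) ∂(D.pathLaw SV s ξ) =
      ∫ ρ, g (Preorder.frestrictLe (π := fun _ => S) n ρ) *
        ∑ x, D.P (ρ n) (SV (ρ n)) x * f x ∂(D.pathLaw SV s ξ) := by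
  have key := Kernel.partialTraj_compProd_eq_map_traj (X := fun _ => S) (κ := D.stepKernel SV ξ)
    (a := 0) (b := n) (Nat.zero_le n) (x₀ := fun _ => s)
  have hm : Measurable (Preorder.frestrictLe (π := fun _ : ℕ => S) n) :=
    Preorder.measurable_frestrictLe n
  have h1 : ∫ ρ, g (Preorder.frestrictLe (π := fun _ => S) n ρ) * f (ρ (n + 1))
      ∂(D.pathLaw SV s ξ) = ∫ z, g z.1 * f z.2
      ∂((D.pathLaw SV s ξ).map fun ρ =>
        (Preorder.frestrictLe (π := fun _ => S) n ρ, ρ (n + 1))) := by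
    rw [integral_map (by fun_prop) (Measurable.of_discrete.aestronglyMeasurable)]
  rw [h1, pathLaw, ← key, Measure.integral_compProd Integrable.of_finite,
    ← Kernel.traj_map_frestrictLe_apply, integral_map hm.aemeasurable
      (Measurable.of_discrete.aestronglyMeasurable)]
  refine integral_congr_ae (Eventually.of_forall fun ρ => ?_)
  simp only [integral_const_mul]
  congr 1
  have h2 : D.stepKernel SV ξ n (Preorder.frestrictLe (π := fun _ => S) n ρ) =
      (D.nextLaw (ρ n) (SV (ρ n))).toMeasure := by
    change (D.nextLaw (ρ n) (if n = 0 then ξ else SV (ρ n))).toMeasure = _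
    rw [if_neg hn]
  rw [h2]
  exact D.integral_nextLaw (hSV _) f

/-- The return collected up to time `n`, completed by the discounted value `v` of the state reached
at time `n`. -/
def truncReturn (acc : Set S) (p : RewardParams) (v : S → ℝ) (n : ℕ) (ρ : ℕ → S) : ℝ :=
  ∑ t ∈ Finset.range n,
      p.reward acc (ρ (t + 1)) * ∏ k ∈ Finset.range t, p.discount acc (ρ (k + 1)) +
    (∏ k ∈ Finset.range n, p.discount acc (ρ (k + 1))) * v (ρ n)


omit [Fintype E] [MeasurableSpace S] [DiscreteMeasurableSpace S] [Fintype S] in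
theorem truncReturn_succ (acc : Set S) (p : RewardParams) (v : S → ℝ) (n : ℕ) (ρ : ℕ → S) :
    truncReturn acc p v (n + 1) ρ = truncReturn acc p v n ρ +
      ((∏ k ∈ Finset.range n, p.discount acc (ρ (k + 1))) *
        (p.reward acc (ρ (n + 1)) + p.discount acc (ρ (n + 1)) * v (ρ (n + 1))) -
      (∏ k ∈ Finset.range n, p.discount acc (ρ (k + 1))) * v (ρ n)) := by
  simp only [truncReturn, Finset.sum_range_succ, Finset.prod_range_succ]
  ring

omit [Fintype E] [MeasurableSpace S] [DiscreteMeasurableSpace S] [Fintype S] in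
theorem truncReturn_congr (acc : Set S) (p : RewardParams) (v : S → ℝ) {n : ℕ} {ρ ρ' : ℕ → S}
    (h : ∀ k ≤ n, ρ k = ρ' k) : truncReturn acc p v n ρ = truncReturn acc p v n ρ' := by
  induction n with
  | zero => simp [truncReturn, h 0 le_rfl]
  | succ n ih =>
    have hp : ∏ k ∈ Finset.range n, p.discount acc (ρ (k + 1)) =
        ∏ k ∈ Finset.range n, p.discount acc (ρ' (k + 1)) :=
      Finset.prod_congr rfl fun k hk => by
        rw [h (k + 1) (by have := Finset.mem_range.1 hk; omega)]
    rw [truncReturn_succ, truncReturn_succ, ih fun k hk => h k (by omega), h n (by omega),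
      h (n + 1) le_rfl, hp]

omit [Fintype E] in
theorem integrable_of_dependsOn_le (D : SDES S E) (SV : S → Finset E) (s : S) (ξ : Finset E)
    (n : ℕ) {F : (ℕ → S) → ℝ} (hF : ∀ ρ ρ' : ℕ → S, (∀ k ≤ n, ρ k = ρ' k) → F ρ = F ρ') :
    Integrable F (D.pathLaw SV s ξ) := by
  -- A history up to time `n` is extended to a path by stopping at time `n`.
  convert D.integrable_comp_frestrictLe SV s ξ n
    (fun h => F fun k => h ⟨min k n, Finset.mem_Iic.2 (min_le_right k n)⟩) using 2 with ρ
  refine hF _ _ fun k hk => ?_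
  simp [hk]

/-- The expected increment of the truncated returns is the discounted Bellman residual of `v`. -/
theorem integral_truncReturn_succ (D : SDES S E) (acc : Set S) (p : RewardParams)
    (SV : S → Finset E) (hSV : ∀ s, SV s ∈ D.dir s) (s : S) (ξ : Finset E) (v : S → ℝ) {n : ℕ}
    (hn : n ≠ 0) :
    ∫ ρ, truncReturn acc p v (n + 1) ρ ∂(D.pathLaw SV s ξ) =
      ∫ ρ, truncReturn acc p v n ρ ∂(D.pathLaw SV s ξ) +
      ∫ ρ, (∏ k ∈ Finset.range n, p.discount acc (ρ (k + 1))) *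
        (D.backup acc p v (ρ n) (SV (ρ n)) - v (ρ n)) ∂(D.pathLaw SV s ξ) := by
  have hprod : ∀ ρ ρ' : ℕ → S, (∀ k ≤ n, ρ k = ρ' k) →
      ∏ k ∈ Finset.range n, p.discount acc (ρ (k + 1)) =
        ∏ k ∈ Finset.range n, p.discount acc (ρ' (k + 1)) := fun ρ ρ' h =>
    Finset.prod_congr rfl fun k hk => by
      rw [h (k + 1) (by have := Finset.mem_range.1 hk; omega)]
  have i1 : Integrable (truncReturn acc p v n) (D.pathLaw SV s ξ) :=
    D.integrable_of_dependsOn_le SV s ξ n fun ρ ρ' h => truncReturn_congr acc p v h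
  have i2 : Integrable (fun ρ : ℕ → S => (∏ k ∈ Finset.range n, p.discount acc (ρ (k + 1))) *
        (p.reward acc (ρ (n + 1)) + p.discount acc (ρ (n + 1)) * v (ρ (n + 1))))
      (D.pathLaw SV s ξ) :=
    D.integrable_of_dependsOn_le SV s ξ (n + 1) fun ρ ρ' h => by
      rw [hprod ρ ρ' fun k hk => h k (by omega), h (n + 1) le_rfl]
  have i3 : Integrable (fun ρ : ℕ → S => (∏ k ∈ Finset.range n, p.discount acc (ρ (k + 1))) *
        v (ρ n)) (D.pathLaw SV s ξ) :=
    D.integrable_of_dependsOn_le SV s ξ n fun ρ ρ' h => by rw [hprod ρ ρ' h, h n le_rfl]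
  have i4 : Integrable (fun ρ : ℕ → S => (∏ k ∈ Finset.range n, p.discount acc (ρ (k + 1))) *
        D.backup acc p v (ρ n) (SV (ρ n))) (D.pathLaw SV s ξ) :=
    D.integrable_of_dependsOn_le SV s ξ n fun ρ ρ' h => by rw [hprod ρ ρ' h, h n le_rfl]
  have key : ∫ ρ, (∏ k ∈ Finset.range n, p.discount acc (ρ (k + 1))) *
        (p.reward acc (ρ (n + 1)) + p.discount acc (ρ (n + 1)) * v (ρ (n + 1)))
        ∂(D.pathLaw SV s ξ) =
      ∫ ρ, (∏ k ∈ Finset.range n, p.discount acc (ρ (k + 1))) *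
        D.backup acc p v (ρ n) (SV (ρ n)) ∂(D.pathLaw SV s ξ) := by
    have := D.integral_pathLaw_succ SV hSV s ξ hn
      (fun h => ∏ k ∈ Finset.range n, p.discount acc
        (h ⟨min (k + 1) n, Finset.mem_Iic.2 (min_le_right _ n)⟩))
      (fun x => p.reward acc x + p.discount acc x * v x)
    have e : ∀ ρ : ℕ → S, (∏ k ∈ Finset.range n, p.discount acc
        (Preorder.frestrictLe (π := fun _ => S) n ρ
          ⟨min (k + 1) n, Finset.mem_Iic.2 (min_le_right _ n)⟩)) =
        ∏ k ∈ Finset.range n, p.discount acc (ρ (k + 1)) := fun ρ =>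
      Finset.prod_congr rfl fun k hk => by
        have : min (k + 1) n = k + 1 := min_eq_left (Finset.mem_range.1 hk)
        simp [this]
    simpa only [e, backup] using this
  simp only [truncReturn_succ, mul_sub]
  have h1 := integral_add i1 (i2.sub i3)
  simp only [Pi.sub_apply] at h1
  rw [h1, integral_sub i2 i3, integral_sub i4 i3, key]

theorem integral_truncReturn_one (D : SDES S E) (acc : Set S) (p : RewardParams)
    (SV : S → Finset E) {s : S} {ξ : Finset E} (hξ : ξ ∈ D.dir s) (v : S → ℝ) :
    ∫ ρ, truncReturn acc p v 1 ρ ∂(D.pathLaw SV s ξ) = D.backup acc p v s ξ := by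
  have hmap : (D.pathLaw SV s ξ).map (fun ρ => ρ 1) = (D.nextLaw s ξ).toMeasure := by
    have := congrArg (fun κ => κ fun _ => s)
      (Kernel.map_traj_succ_self (X := fun _ => S) (κ := D.stepKernel SV ξ) (a := 0))
    rw [Kernel.map_apply _ (measurable_pi_apply _)] at this
    refine this.trans ?_
    change (D.nextLaw s (if 0 = 0 then ξ else SV s)).toMeasure = _
    rw [if_pos rfl]
  have := D.integral_nextLaw hξ fun x => p.reward acc x + p.discount acc x * v x
  rw [← hmap, integral_map (measurable_pi_apply 1).aemeasurable
    Measurable.of_discrete.aestronglyMeasurable] at this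
  rw [backup, ← this]
  simp [truncReturn]

omit [Fintype E] in
theorem tendsto_integral_truncReturn (D : SDES S E) (acc : Set S) (p : RewardParams)
    (SV : S → Finset E) (s : S) (ξ : Finset E) (v : S → ℝ) :
    Tendsto (fun n => ∫ ρ, truncReturn acc p v n ρ ∂(D.pathLaw SV s ξ)) atTop
      (𝓝 (∫ ρ, p.pathReturn acc ρ ∂(D.pathLaw SV s ξ))) := by
  obtain ⟨C, hC⟩ : ∃ C, ∀ x, |v x| ≤ C := by
    obtain ⟨C, hC⟩ := (Set.finite_range fun x => |v x|).bddAbove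
    exact ⟨C, fun x => hC ⟨x, rfl⟩⟩
  have hpow : ∀ n : ℕ, p.maxDiscount ^ n ≤ 1 := fun n =>
    pow_le_one₀ p.maxDiscount_pos.le p.maxDiscount_lt_one.le
  have hgeo := summable_geometric_of_lt_one p.maxDiscount_pos.le p.maxDiscount_lt_one
  have hrest : ∀ n (ρ : ℕ → S), |(∏ k ∈ Finset.range n, p.discount acc (ρ (k + 1))) * v (ρ n)| ≤
      p.maxDiscount ^ n * C := fun n ρ => by
    rw [abs_mul, abs_of_nonneg (p.prod_discount_nonneg acc ρ n)]
    exact mul_le_mul (p.prod_discount_le acc ρ n) (hC _) (abs_nonneg _)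
      (pow_nonneg p.maxDiscount_pos.le n)
  refine tendsto_integral_of_dominated_convergence
    (fun _ => |p.rn| * (∑' t : ℕ, p.maxDiscount ^ t) + |C|)
    (fun n => (D.integrable_of_dependsOn_le SV s ξ n
      fun ρ ρ' h => truncReturn_congr acc p v h).aestronglyMeasurable)
    (integrable_const _) ?_ ?_
  · intro n
    refine Eventually.of_forall fun ρ => ?_
    rw [Real.norm_eq_abs]
    refine (abs_add_le _ _).trans (add_le_add ?_ ?_)
    · refine (Finset.abs_sum_le_sum_abs _ _).trans ?_
      refine le_trans (Finset.sum_le_sum (g := fun t => |p.rn| * p.maxDiscount ^ t) fun t _ => ?_)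
        ?_
      · rw [abs_mul, abs_of_nonneg (p.prod_discount_nonneg acc ρ t)]
        exact mul_le_mul (p.abs_reward_le acc _) (p.prod_discount_le acc ρ t)
          (p.prod_discount_nonneg acc ρ t) (abs_nonneg _)
      · rw [← Finset.mul_sum]
        exact mul_le_mul_of_nonneg_left (hgeo.sum_le_tsum _
          fun t _ => pow_nonneg p.maxDiscount_pos.le t) (abs_nonneg _)
    · refine (hrest n ρ).trans ?_
      have := mul_le_mul (hpow n) (le_abs_self C) ((abs_nonneg _).trans (hC (ρ 0))) zero_le_one
      linarith
  · refine Eventually.of_forall fun ρ => ?_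
    have h1 := (p.summable_pathReturn acc ρ).hasSum.tendsto_sum_nat
    have h2 : Tendsto (fun n => (∏ k ∈ Finset.range n, p.discount acc (ρ (k + 1))) * v (ρ n))
        atTop (𝓝 0) := by
      refine squeeze_zero_norm (hrest · ρ) ?_
      simpa using (tendsto_pow_atTop_nhds_zero_of_lt_one p.maxDiscount_pos.le
        p.maxDiscount_lt_one).mul_const C
    simpa [truncReturn, RewardParams.pathReturn] using h1.add h2

/-- A function whose Bellman residual along `SV` is nonpositive bounds the values of `SV`. -/
theorem QValue_le_backup (D : SDES S E) (acc : Set S) (p : RewardParams)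
    (SV : D.DirectedController) {s : S} {ξ : Finset E} (hξ : ξ ∈ D.dir s) {v : S → ℝ}
    (hv : ∀ x, D.backup acc p v x (SV.1 x) ≤ v x) :
    D.QValue acc p SV s ξ ≤ D.backup acc p v s ξ := by
  refine le_of_tendsto (D.tendsto_integral_truncReturn acc p SV.1 s ξ v)
    (eventually_atTop.2 ⟨1, fun n hn => ?_⟩)
  induction n, hn using Nat.le_induction with
  | base => exact (D.integral_truncReturn_one acc p SV.1 hξ v).le
  | succ n hn ih =>
    rw [D.integral_truncReturn_succ acc p SV.1 SV.2 s ξ v (by omega)]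
    refine le_trans (add_le_of_nonpos_right (integral_nonpos fun ρ => ?_)) ih
    exact mul_nonpos_of_nonneg_of_nonpos (p.prod_discount_nonneg acc ρ n)
      (sub_nonpos.2 (hv (ρ n)))

/-- A function whose Bellman residual along `SV` vanishes gives the values of `SV`. -/
theorem QValue_eq_backup (D : SDES S E) (acc : Set S) (p : RewardParams)
    (SV : D.DirectedController) {s : S} {ξ : Finset E} (hξ : ξ ∈ D.dir s) {v : S → ℝ}
    (hv : ∀ x, D.backup acc p v x (SV.1 x) = v x) :
    D.QValue acc p SV s ξ = D.backup acc p v s ξ := by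
  suffices h : ∀ n, 1 ≤ n →
      ∫ ρ, truncReturn acc p v n ρ ∂(D.pathLaw SV.1 s ξ) = D.backup acc p v s ξ from
    tendsto_nhds_unique (D.tendsto_integral_truncReturn acc p SV.1 s ξ v)
      (tendsto_const_nhds.congr' (eventually_atTop.2 ⟨1, fun n hn => (h n hn).symm⟩))
  intro n hn
  induction n, hn using Nat.le_induction with
  | base => exact D.integral_truncReturn_one acc p SV.1 hξ v
  | succ n hn ih =>
    rw [D.integral_truncReturn_succ acc p SV.1 SV.2 s ξ v (by omega), ih]
    simp [hv]

/-- The optimal values solve the Bellman optimality equation: a greedy controller for the fixed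
point of the Bellman operator attains it, and no controller exceeds it. -/
theorem QStar_eq_backup (D : SDES S E) (acc : Set S) (p : RewardParams)
    (hne : ∀ s, (D.dir s).Nonempty) {s : S} {ξ : Finset E} (hξ : ξ ∈ D.dir s) :
    D.QStar acc p s ξ = D.backup acc p (D.maxDir (D.QStar acc p)) s ξ := by
  obtain ⟨v, hv⟩ := D.exists_bellman_fixedPoint acc p hne
  have hle : ∀ (SV : D.DirectedController) (s : S), ∀ ξ ∈ D.dir s,
      D.QValue acc p SV s ξ ≤ D.backup acc p v s ξ := fun SV s ξ hξ =>
    D.QValue_le_backup acc p SV hξ fun x => by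
      rw [hv x]
      exact D.le_maxDir _ (SV.2 x)
  choose g hg hgv using fun x => D.exists_maxDir_eq (D.backup acc p v) (hne x)
  have heq : ∀ s, ∀ ξ ∈ D.dir s, D.QStar acc p s ξ = D.backup acc p v s ξ := fun s ξ hξ => by
    have : Nonempty D.DirectedController := ⟨⟨g, hg⟩⟩
    refine le_antisymm (ciSup_le fun SV => hle SV s ξ hξ) ?_
    have h := D.QValue_eq_backup acc p ⟨g, hg⟩ hξ (v := v) fun x => by rw [hv x, hgv x]
    rw [← h]
    exact le_ciSup (f := fun SV => D.QValue acc p SV s ξ)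
      ⟨_, by rintro _ ⟨SV, rfl⟩; exact hle SV s ξ hξ⟩ ⟨g, hg⟩
  have hV : D.maxDir (D.QStar acc p) = v := by
    funext x
    rw [hv x]
    exact D.maxDir_congr (heq x)
  rw [hV, heq s ξ hξ]

end Verification

end SDES


/-! ### Martingale tools -/

section Martingale

variable {Ω : Type*} [mΩ : MeasurableSpace Ω] {μ : Measure Ω} [IsProbabilityMeasure μ]

/-- Almost every point of `A` has positive conditional probability of `A`. -/
theorem ae_condExp_indicator_pos {m : MeasurableSpace Ω} (hm : m ≤ mΩ) {A : Set Ω}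
    (hA : MeasurableSet[mΩ] A) :
    ∀ᵐ ω ∂μ, ω ∈ A → 0 < (μ[A.indicator (fun _ => (1 : ℝ)) | m]) ω := by
  set f := μ[A.indicator (fun _ => (1 : ℝ)) | m] with hf
  have hfm : Measurable[m] f := stronglyMeasurable_condExp.measurable
  have hmeas : MeasurableSet[m] {ω | f ω ≤ 0} := hfm measurableSet_Iic
  have hint : Integrable (A.indicator (fun _ => (1 : ℝ))) μ :=
    (integrable_const 1).indicator hA
  have h1 := setIntegral_condExp hm hint hmeas
  have h2 : ∫ ω in {ω | f ω ≤ 0}, f ω ∂μ ≤ 0 :=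
    setIntegral_nonpos (hm _ hmeas) fun ω hω => hω
  rw [← hf] at h1
  rw [h1, setIntegral_indicator hA, setIntegral_const, smul_eq_mul, mul_one] at h2
  have h3 : μ ({ω | f ω ≤ 0} ∩ A) = 0 := by
    have := le_antisymm h2 measureReal_nonneg
    rwa [measureReal_eq_zero_iff] at this
  rw [ae_iff]
  convert h3 using 2
  ext ω
  simp [and_comm]

/-- The centred indicators of events `A n` which are revealed at time `n + 1`. -/
def centredIndicator (μ : Measure Ω) (ℱ : Filtration ℕ mΩ) (A : ℕ → Set Ω) (n : ℕ) (ω : Ω) : ℝ :=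
  (A n).indicator (fun _ => (1 : ℝ)) ω - (μ[(A n).indicator (fun _ => (1 : ℝ)) | ℱ n]) ω

variable {ℱ : Filtration ℕ mΩ} {A : ℕ → Set Ω}

omit [IsProbabilityMeasure μ] in
theorem stronglyMeasurable_centredIndicator (hA : ∀ n, MeasurableSet[ℱ (n + 1)] (A n)) (n : ℕ) :
    StronglyMeasurable[ℱ (n + 1)] (centredIndicator μ ℱ A n) :=
  (stronglyMeasurable_const.indicator (hA n)).sub
    (stronglyMeasurable_condExp.mono (ℱ.mono n.le_succ))

theorem integrable_centredIndicator (hA : ∀ n, MeasurableSet[ℱ (n + 1)] (A n)) (n : ℕ) :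
    Integrable (centredIndicator μ ℱ A n) μ :=
  ((integrable_const 1).indicator (ℱ.le _ _ (hA n))).sub integrable_condExp

theorem condExp_centredIndicator (hA : ∀ n, MeasurableSet[ℱ (n + 1)] (A n)) (n : ℕ) :
    μ[centredIndicator μ ℱ A n | ℱ n] =ᵐ[μ] 0 := by
  have h1 := condExp_sub (μ := μ) ((integrable_const (1 : ℝ)).indicator (ℱ.le _ _ (hA n)))
    (integrable_condExp (m := ℱ n) (f := (A n).indicator fun _ => (1 : ℝ))) (ℱ n)
  refine h1.trans ?_
  rw [condExp_of_stronglyMeasurable (ℱ.le n) stronglyMeasurable_condExp integrable_condExp,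
    sub_self]

theorem abs_centredIndicator_le (hA : ∀ n, MeasurableSet[ℱ (n + 1)] (A n)) (n : ℕ) :
    ∀ᵐ ω ∂μ, |centredIndicator μ ℱ A n ω| ≤ 1 := by
  have hint : Integrable ((A n).indicator fun _ => (1 : ℝ)) μ :=
    (integrable_const (1 : ℝ)).indicator (ℱ.le _ _ (hA n))
  have h0 : 0 ≤ᵐ[μ] μ[(A n).indicator (fun _ => (1 : ℝ)) | ℱ n] :=
    condExp_nonneg (Eventually.of_forall fun ω => Set.indicator_nonneg (fun _ _ => zero_le_one) ω)
  have h1 : μ[(A n).indicator (fun _ => (1 : ℝ)) | ℱ n] ≤ᵐ[μ] μ[fun _ => (1 : ℝ) | ℱ n] :=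
    condExp_mono hint (integrable_const 1) (Eventually.of_forall fun ω =>
      Set.indicator_le_self' (fun _ _ => zero_le_one) ω)
  rw [condExp_const (ℱ.le n)] at h1
  filter_upwards [h0, h1] with ω h0 h1
  have h2 : (A n).indicator (fun _ => (1 : ℝ)) ω = 0 ∨
      (A n).indicator (fun _ => (1 : ℝ)) ω = 1 := by
    by_cases h : ω ∈ A n <;> simp [h]
  simp only [Pi.zero_apply] at h0
  unfold centredIndicator
  rw [abs_le]
  rcases h2 with h2 | h2 <;> rw [h2] <;> constructor <;> linarith

/-- The martingale transform of the centred indicators by bounded predictable weights. -/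
theorem martingale_sum_mul_centredIndicator (hA : ∀ n, MeasurableSet[ℱ (n + 1)] (A n))
    {c : ℕ → Ω → ℝ} (hc : ∀ n, Measurable[ℱ n] (c n)) {C : ℝ} (hC : ∀ n ω, |c n ω| ≤ C) :
    Martingale (fun n ω => ∑ k ∈ Finset.range n, c k ω * centredIndicator μ ℱ A k ω) ℱ μ := by
  have hint : ∀ k, Integrable (fun ω => c k ω * centredIndicator μ ℱ A k ω) μ := fun k =>
    (integrable_centredIndicator hA k).bdd_mul
      ((hc k).mono (ℱ.le k) le_rfl).aestronglyMeasurable (Eventually.of_forall fun ω => hC k ω)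
  have hadp : ∀ n, StronglyMeasurable[ℱ n]
      (fun ω => ∑ k ∈ Finset.range n, c k ω * centredIndicator μ ℱ A k ω) := fun n => by
    refine Finset.stronglyMeasurable_fun_sum _ fun k hk => ?_
    have hk' : k + 1 ≤ n := Finset.mem_range.1 hk
    exact ((hc k).mono (ℱ.mono (by omega)) le_rfl).stronglyMeasurable.mul
      ((stronglyMeasurable_centredIndicator hA k).mono (ℱ.mono hk'))
  refine martingale_nat hadp (fun n => integrable_finsetSum _ fun k _ => hint k) fun n => ?_
  simp only [Finset.sum_range_succ]
  have h1 := condExp_add (μ := μ)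
    (integrable_finsetSum (Finset.range n) fun k _ => hint k) (hint n) (ℱ n)
  have h2 := condExp_mul_of_stronglyMeasurable_left (μ := μ) (hc n).stronglyMeasurable
    (g := centredIndicator μ ℱ A n) (hint n) (integrable_centredIndicator hA n)
  have h3 := condExp_of_stronglyMeasurable (ℱ.le n) (hadp n)
    (integrable_finsetSum (Finset.range n) fun k _ => hint k) (μ := μ)
  filter_upwards [h1, h2, condExp_centredIndicator (μ := μ) hA n] with ω h1 h2 h4
  have h5 : (μ[fun ω => ∑ k ∈ Finset.range n, c k ω * centredIndicator μ ℱ A k ω +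
      c n ω * centredIndicator μ ℱ A n ω | ℱ n]) ω = _ := h1
  rw [h5, Pi.add_apply, h3]
  have h6 : (μ[fun ω => c n ω * centredIndicator μ ℱ A n ω | ℱ n]) ω = _ := h2
  rw [h6, Pi.mul_apply, h4]
  simp


theorem ae_abs_sum_mul_centredIndicator_le (hA : ∀ n, MeasurableSet[ℱ (n + 1)] (A n))
    {c : ℕ → Ω → ℝ} {C : ℝ} (hC : ∀ n ω, |c n ω| ≤ C) (n : ℕ) :
    ∀ᵐ ω ∂μ, |∑ k ∈ Finset.range n, c k ω * centredIndicator μ ℱ A k ω| ≤ n * C := by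
  filter_upwards [ae_all_iff.2 (abs_centredIndicator_le (μ := μ) hA)] with ω hω
  refine (Finset.abs_sum_le_sum_abs _ _).trans ?_
  refine (Finset.sum_le_sum (g := fun _ => C) fun k _ => ?_).trans (by simp)
  rw [abs_mul]
  exact (mul_le_of_le_one_right (abs_nonneg _) (hω k)).trans (hC k ω)

/-- The second moment of the transform is at most the expected sum of the squared weights. -/
theorem integral_sq_sum_mul_centredIndicator_le (hA : ∀ n, MeasurableSet[ℱ (n + 1)] (A n))
    {c : ℕ → Ω → ℝ} (hc : ∀ n, Measurable[ℱ n] (c n)) {C : ℝ} (hC : ∀ n ω, |c n ω| ≤ C) (n : ℕ) :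
    Integrable (fun ω => (∑ k ∈ Finset.range n, c k ω * centredIndicator μ ℱ A k ω) ^ 2) μ ∧
    ∫ ω, (∑ k ∈ Finset.range n, c k ω * centredIndicator μ ℱ A k ω) ^ 2 ∂μ ≤
      ∫ ω, ∑ k ∈ Finset.range n, c k ω ^ 2 ∂μ := by
  have hmart := martingale_sum_mul_centredIndicator (μ := μ) hA hc hC
  have hsm := fun n => hmart.stronglyMeasurable n
  have hcm : ∀ k, AEStronglyMeasurable (c k) μ := fun k =>
    ((hc k).mono (ℱ.le k) le_rfl).aestronglyMeasurable
  have hYm : ∀ k, AEStronglyMeasurable (centredIndicator μ ℱ A k) μ := fun k =>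
    (integrable_centredIndicator hA k).aestronglyMeasurable
  have hXm : ∀ n, AEStronglyMeasurable
      (fun ω => ∑ k ∈ Finset.range n, c k ω * centredIndicator μ ℱ A k ω) μ := fun n =>
    (hmart.integrable n).aestronglyMeasurable
  have hX := fun n => ae_abs_sum_mul_centredIndicator_le (μ := μ) hA hC n
  have hc2 : ∀ k, Integrable (fun ω => c k ω ^ 2) μ := fun k =>
    Integrable.of_bound ((hcm k).pow 2) (C ^ 2) (Eventually.of_forall fun ω => by
      rw [Real.norm_eq_abs, abs_pow]
      exact pow_le_pow_left₀ (abs_nonneg _) (hC k ω) 2)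
  have hX2 : ∀ n, Integrable
      (fun ω => (∑ k ∈ Finset.range n, c k ω * centredIndicator μ ℱ A k ω) ^ 2) μ := fun n => by
    refine Integrable.of_bound ((hXm n).pow 2) ((n * C) ^ 2) ?_
    filter_upwards [hX n] with ω hω
    rw [Real.norm_eq_abs, abs_pow]
    exact pow_le_pow_left₀ (abs_nonneg _) hω 2
  refine ⟨hX2 n, ?_⟩
  induction n with
  | zero => simp
  | succ n ih =>
    set X : Ω → ℝ := fun ω => ∑ k ∈ Finset.range n, c k ω * centredIndicator μ ℱ A k ω with hXdef
    set Y := centredIndicator μ ℱ A n with hY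
    have hXc : Integrable (fun ω => (X ω * c n ω) * Y ω) μ := by
      refine (integrable_centredIndicator hA n).bdd_mul (c := n * C * C)
        ((hXm n).mul (hcm n)) ?_
      filter_upwards [hX n] with ω hω
      rw [Real.norm_eq_abs, abs_mul]
      exact mul_le_mul hω (hC n ω) (abs_nonneg _) ((abs_nonneg _).trans hω)
    have hcross : ∫ ω, (X ω * c n ω) * Y ω ∂μ = 0 := by
      rw [← integral_condExp (ℱ.le n)]
      refine (integral_congr_ae ?_).trans (integral_zero' Ω ℝ)
      have h2 := condExp_mul_of_stronglyMeasurable_left (μ := μ)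
        ((hsm n).mul (hc n).stronglyMeasurable) (g := Y) hXc (integrable_centredIndicator hA n)
      filter_upwards [h2, condExp_centredIndicator (μ := μ) hA n] with ω h2 h4
      refine Eq.trans h2 ?_
      rw [Pi.mul_apply, h4]
      simp
    have hcY : Integrable (fun ω => (c n ω * Y ω) ^ 2) μ := by
      refine Integrable.of_bound (((hcm n).mul (hYm n)).pow 2) (C ^ 2) ?_
      filter_upwards [abs_centredIndicator_le (μ := μ) hA n] with ω hω
      rw [Real.norm_eq_abs, abs_pow, abs_mul]
      refine pow_le_pow_left₀ (mul_nonneg (abs_nonneg _) (abs_nonneg _)) ?_ 2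
      exact (mul_le_of_le_one_right (abs_nonneg _) hω).trans (hC n ω)
    have hcY' : ∫ ω, (c n ω * Y ω) ^ 2 ∂μ ≤ ∫ ω, c n ω ^ 2 ∂μ := by
      refine integral_mono_ae hcY (hc2 n) ?_
      filter_upwards [abs_centredIndicator_le (μ := μ) hA n] with ω hω
      rw [mul_pow]
      exact mul_le_of_le_one_right (sq_nonneg _) ((sq_le_one_iff_abs_le_one _).2 hω)
    have e : ∀ ω, (X ω + c n ω * Y ω) ^ 2 =
        X ω ^ 2 + 2 * ((X ω * c n ω) * Y ω) + (c n ω * Y ω) ^ 2 := fun ω => by ring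
    simp only [Finset.sum_range_succ]
    change ∫ ω, (X ω + c n ω * Y ω) ^ 2 ∂μ ≤ _
    simp only [e]
    have i1 : Integrable (fun ω => X ω ^ 2 + 2 * ((X ω * c n ω) * Y ω)) μ :=
      (hX2 n).add (hXc.const_mul 2)
    rw [integral_add i1 hcY, integral_add (hX2 n) (hXc.const_mul 2), integral_const_mul, hcross,
      integral_add (integrable_finsetSum _ fun k _ => hc2 k) (hc2 n)]
    linarith

/-- Convergence of the transform for weights whose squares have a bounded sum: the martingale is
bounded in `L²`, hence in `L¹`. -/
theorem ae_tendsto_sum_of_sum_sq_le (hA : ∀ n, MeasurableSet[ℱ (n + 1)] (A n))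
    {c : ℕ → Ω → ℝ} (hc : ∀ n, Measurable[ℱ n] (c n)) {N : ℝ}
    (hN : ∀ n ω, ∑ k ∈ Finset.range n, c k ω ^ 2 ≤ N) :
    ∀ᵐ ω ∂μ, ∃ l, Tendsto
      (fun n => ∑ k ∈ Finset.range n, c k ω * centredIndicator μ ℱ A k ω) atTop (𝓝 l) := by
  have hC : ∀ n ω, |c n ω| ≤ Real.sqrt N := fun n ω => by
    refine Real.abs_le_sqrt (le_trans ?_ (hN (n + 1) ω))
    rw [Finset.sum_range_succ]
    exact le_add_of_nonneg_left (Finset.sum_nonneg fun _ _ => sq_nonneg _)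
  have hmart := martingale_sum_mul_centredIndicator (μ := μ) hA hc hC
  refine hmart.submartingale.exists_ae_tendsto_of_bdd (R := (1 + N).toNNReal) fun n => ?_
  obtain ⟨hi, hle⟩ := integral_sq_sum_mul_centredIndicator_le (μ := μ) hA hc hC n
  rw [eLpNorm_one_eq_lintegral_enorm, ← ofReal_integral_norm_eq_lintegral_enorm
    (hmart.integrable n)]
  change _ ≤ ENNReal.ofReal (1 + N)
  refine ENNReal.ofReal_le_ofReal ?_
  have h1 : ∫ ω, ∑ k ∈ Finset.range n, c k ω ^ 2 ∂μ ≤ N := by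
    have : ∫ _ω : Ω, N ∂μ = N := by simp
    rw [← this]
    refine integral_mono_of_nonneg (Eventually.of_forall fun ω =>
      Finset.sum_nonneg fun _ _ => sq_nonneg _) (integrable_const N)
      (Eventually.of_forall fun ω => hN n ω)
  calc _ ≤ ∫ ω, (1 + (∑ k ∈ Finset.range n, c k ω * centredIndicator μ ℱ A k ω) ^ 2) ∂μ := by
        refine integral_mono (hmart.integrable n).norm ((integrable_const 1).add hi) fun ω => ?_
        simp only [Real.norm_eq_abs]
        rw [← sq_abs]
        nlinarith [sq_nonneg (|∑ k ∈ Finset.range n, c k ω * centredIndicator μ ℱ A k ω| - 1),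
          abs_nonneg (∑ k ∈ Finset.range n, c k ω * centredIndicator μ ℱ A k ω)]
    _ ≤ 1 + N := by
        rw [integral_add (integrable_const 1) hi]
        simp only [integral_const, probReal_univ, smul_eq_mul, mul_one]
        linarith

/-- The sum of centred indicators with predictable weights converges almost surely where the
weights are square-summable. The weights are cut off when the sum of their squares exceeds a bound
`N`; for `N` large, the cut-off does not change them. -/
theorem ae_tendsto_sum_of_summable_sq (hA : ∀ n, MeasurableSet[ℱ (n + 1)] (A n))
    {c : ℕ → Ω → ℝ} (hc : ∀ n, Measurable[ℱ n] (c n)) :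
    ∀ᵐ ω ∂μ, Summable (fun n => c n ω ^ 2) → ∃ l, Tendsto
      (fun n => ∑ k ∈ Finset.range n, c k ω * centredIndicator μ ℱ A k ω) atTop (𝓝 l) := by
  let t : ℕ → ℕ → Set Ω := fun N k => {ω | ∑ j ∈ Finset.range (k + 1), c j ω ^ 2 ≤ N}
  let d : ℕ → ℕ → Ω → ℝ := fun N k => (t N k).indicator (c k)
  have hd : ∀ N n, Measurable[ℱ n] (d N n) := fun N n => by
    refine (hc n).indicator ?_
    have : Measurable[ℱ n] fun ω => ∑ j ∈ Finset.range (n + 1), c j ω ^ 2 :=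
      Finset.measurable_fun_sum _ fun j hj =>
        ((hc j).mono (ℱ.mono (Nat.lt_succ_iff.1 (Finset.mem_range.1 hj))) le_rfl).pow_const 2
    exact this measurableSet_Iic
  have hdN : ∀ N n ω, ∑ k ∈ Finset.range n, d N k ω ^ 2 ≤ (N : ℝ) := fun N n ω => by
    induction n with
    | zero => simp
    | succ n ih =>
      rw [Finset.sum_range_succ]
      by_cases h : ω ∈ t N n
      · refine le_trans ?_ (h : ∑ j ∈ Finset.range (n + 1), c j ω ^ 2 ≤ N)
        rw [Finset.sum_range_succ]
        refine add_le_add (Finset.sum_le_sum fun k _ => ?_) ?_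
        · by_cases h' : ω ∈ t N k
          · simp [d, h']
          · simp only [d, Set.indicator_of_notMem h']
            simpa using sq_nonneg (c k ω)
        · simp [d, h]
      · simpa [d, h] using ih
  have hconv := ae_all_iff.2 fun N => ae_tendsto_sum_of_sum_sq_le (μ := μ) hA (hd N) (hdN N)
  filter_upwards [hconv] with ω hω hs
  obtain ⟨N, hN⟩ := exists_nat_ge (∑' n, c n ω ^ 2)
  obtain ⟨l, hl⟩ := hω N
  refine ⟨l, hl.congr fun n => Finset.sum_congr rfl fun k _ => ?_⟩
  have : ω ∈ t N k := (hs.sum_le_tsum _ fun _ _ => sq_nonneg _).trans hN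
  simp [d, this]

/-- A conditional Borel–Cantelli lemma: if `A n` has conditional probability at least `c > 0` at
infinitely many times at which `B n` holds, then `A n ∩ B n` occurs infinitely often. -/
theorem ae_frequently_inter_of_frequently_le_condExp {B : ℕ → Set Ω}
    (hA : ∀ n, MeasurableSet[ℱ (n + 1)] (A n)) (hB : ∀ n, MeasurableSet[ℱ n] (B n)) :
    ∀ᵐ ω ∂μ, ∀ c > 0,
      (∃ᶠ n in atTop, ω ∈ B n ∧ c ≤ (μ[(A n).indicator (fun _ => (1 : ℝ)) | ℱ n]) ω) →
      ∃ᶠ n in atTop, ω ∈ A n ∩ B n := by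
  let s : ℕ → Set Ω := fun n => Nat.casesOn n ∅ fun k => A k ∩ B k
  have hs : ∀ n, MeasurableSet[ℱ n] (s n) := fun n => by
    cases n with
    | zero => exact @MeasurableSet.empty _ (ℱ 0)
    | succ k => exact (hA k).inter (ℱ.mono k.le_succ _ (hB k))
  have hcond : ∀ n, μ[(s (n + 1)).indicator (1 : Ω → ℝ) | ℱ n] =ᵐ[μ]
      (B n).indicator (μ[(A n).indicator (fun _ => (1 : ℝ)) | ℱ n]) := fun n => by
    have h := condExp_indicator (μ := μ)
      ((integrable_const (1 : ℝ)).indicator (ℱ.le _ _ (hA n))) (hB n)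
    rw [Set.indicator_indicator, Set.inter_comm] at h
    exact h
  have hnn : ∀ n, 0 ≤ᵐ[μ] μ[(A n).indicator (fun _ => (1 : ℝ)) | ℱ n] := fun n =>
    condExp_nonneg (Eventually.of_forall fun ω => Set.indicator_nonneg (fun _ _ => zero_le_one) ω)
  filter_upwards [ae_mem_limsup_atTop_iff μ hs, ae_all_iff.2 hcond, ae_all_iff.2 hnn]
    with ω h1 h2 h3 c hc hfreq
  have h4 : ω ∈ limsup s atTop := by
    refine h1.2 ?_
    simp only [h2]
    refine (not_summable_iff_tendsto_nat_atTop_of_nonneg fun n =>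
      Set.indicator_apply_nonneg fun _ => h3 n).1 fun hsum => ?_
    obtain ⟨n, ⟨hn, hle⟩, hlt⟩ :=
      (hfreq.and_eventually (hsum.tendsto_atTop_zero.eventually (gt_mem_nhds hc))).exists
    rw [Set.indicator_of_mem hn] at hlt
    exact absurd hlt (not_lt.2 hle)
  rw [mem_limsup_iff_frequently_mem, frequently_atTop] at h4
  refine frequently_atTop.2 fun m => ?_
  obtain ⟨n, hn, hmem⟩ := h4 (m + 1)
  obtain ⟨k, rfl⟩ := Nat.exists_eq_add_of_le' (le_trans (Nat.le_add_left 1 m) hn)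
  exact ⟨k, by omega, hmem⟩

end Martingale


/-! ### Asynchronous contractions with summable noise -/

section Asynchronous

/-- Averaging towards values at most `c` with step sizes of infinite sum. -/
theorem eventually_le_of_averaging {a u : ℕ → ℝ} {c : ℝ} (ha : ∀ n, 0 ≤ a n)
    (ha0 : Tendsto a atTop (𝓝 0)) (hs : ¬ Summable a)
    (hu : ∀ᶠ n in atTop, u (n + 1) ≤ (1 - a n) * u n + a n * c) {ε : ℝ} (hε : 0 < ε) :
    ∀ᶠ n in atTop, u n ≤ c + ε := by
  obtain ⟨m, hm⟩ := eventually_atTop.1 (hu.and (ha0.eventually (ge_mem_nhds zero_lt_one)))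
  -- The excess over `c` shrinks by the factors `1 - a n ≤ exp (-a n)`, whose product vanishes.
  have hbound : ∀ k, u (m + k) - c ≤
      Real.exp (-∑ j ∈ Finset.range k, a (j + m)) * max (u m - c) 0 := by
    intro k
    induction k with
    | zero => simp
    | succ k ih =>
      obtain ⟨h1, h2⟩ := hm (m + k) (Nat.le_add_right m k)
      have h3 : 1 - a (m + k) ≤ Real.exp (-a (k + m)) := by
        have := Real.add_one_le_exp (-a (k + m))
        rw [add_comm m k]
        linarith
      have h4 : 0 ≤ Real.exp (-∑ j ∈ Finset.range k, a (j + m)) * max (u m - c) 0 :=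
        mul_nonneg (Real.exp_pos _).le (le_max_right _ _)
      rw [Finset.sum_range_succ, neg_add, Real.exp_add]
      calc u (m + (k + 1)) - c ≤ (1 - a (m + k)) * (u (m + k) - c) := by
            have : u (m + (k + 1)) = u (m + k + 1) := rfl
            rw [this]
            linarith
        _ ≤ (1 - a (m + k)) * (Real.exp (-∑ j ∈ Finset.range k, a (j + m)) * max (u m - c) 0) :=
            mul_le_mul_of_nonneg_left ih (sub_nonneg.2 h2)
        _ ≤ Real.exp (-a (k + m)) *
            (Real.exp (-∑ j ∈ Finset.range k, a (j + m)) * max (u m - c) 0) :=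
            mul_le_mul_of_nonneg_right h3 h4
        _ = _ := by ring
  have hsum : Tendsto (fun k => ∑ j ∈ Finset.range k, a (j + m)) atTop atTop :=
    (not_summable_iff_tendsto_nat_atTop_of_nonneg fun n => ha (n + m)).1
      (mt (summable_nat_add_iff m).1 hs)
  have hlim : Tendsto (fun k => Real.exp (-∑ j ∈ Finset.range k, a (j + m)) * max (u m - c) 0)
      atTop (𝓝 0) := by
    simpa using (Real.tendsto_exp_neg_atTop_nhds_zero.comp hsum).mul_const (max (u m - c) 0)
  obtain ⟨k₀, hk₀⟩ := eventually_atTop.1 (hlim.eventually (ge_mem_nhds hε))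
  refine eventually_atTop.2 ⟨m + k₀, fun n hn => ?_⟩
  obtain ⟨k, rfl⟩ := Nat.exists_eq_add_of_le (le_trans (Nat.le_add_right m k₀) hn)
  have := hbound k
  have := hk₀ k (by omega)
  linarith

variable {ι : Type*} [Finite ι]

/-- Averages of targets of subcritical linear growth stay bounded. -/
theorem exists_bound_of_averaging {a q y : ℕ → ι → ℝ} {β R : ℝ} (hβ : β < 1)
    (ha : ∀ n i, 0 ≤ a n i) (ha0 : ∀ i, Tendsto (fun n => a n i) atTop (𝓝 0))
    (hq : ∀ n i, q (n + 1) i = (1 - a n i) * q n i + a n i * y n i)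
    (hy : ∀ n c, 0 ≤ c → (∀ j, |q n j| ≤ c) → ∀ i, |y n i| ≤ R + β * c) :
    ∃ C, ∀ n i, |q n i| ≤ C := by
  have hfin : ∀ n, ∃ C, ∀ i, |q n i| ≤ C := fun n => by
    obtain ⟨C, hC⟩ := (Set.finite_range fun i => |q n i|).bddAbove
    exact ⟨C, fun i => hC ⟨i, rfl⟩⟩
  choose B hB using hfin
  obtain ⟨m, hm⟩ := eventually_atTop.1
    (eventually_all.2 fun i => (ha0 i).eventually (ge_mem_nhds zero_lt_one))
  -- From time `m` on, when the step sizes are at most one, updates are convex combinations, and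
  -- targets within `C` of zero are mapped into the same range, as `R + β * C ≤ C`.
  set C := max (B m) (|R| / (1 - β)) with hC
  have hC0 : 0 ≤ C := le_max_of_le_right (div_nonneg (abs_nonneg _) (by linarith))
  have hRC : R + β * C ≤ C := by
    have h1 : |R| / (1 - β) ≤ C := le_max_right _ _
    rw [div_le_iff₀ (by linarith)] at h1
    have := le_abs_self R
    linarith
  have htail : ∀ n, m ≤ n → ∀ i, |q n i| ≤ C := by
    intro n hn
    induction n, hn using Nat.le_induction with
    | base => exact fun i => (hB m i).trans (le_max_left _ _)
    | succ n hn ih =>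
      intro i
      have h1 : 0 ≤ 1 - a n i := sub_nonneg.2 (hm n hn i)
      have h2 := (hy n C hC0 ih i).trans hRC
      rw [hq]
      refine (abs_add_le _ _).trans ?_
      rw [abs_mul, abs_mul, abs_of_nonneg h1, abs_of_nonneg (ha n i)]
      have := mul_le_mul_of_nonneg_left (ih i) h1
      have := mul_le_mul_of_nonneg_left h2 (ha n i)
      linarith
  refine ⟨∑ k ∈ Finset.range m, |B k| + C, fun n i => ?_⟩
  rcases le_or_gt m n with h | h
  · have : 0 ≤ ∑ k ∈ Finset.range m, |B k| := Finset.sum_nonneg fun _ _ => abs_nonneg _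
    linarith [htail n h i]
  · have := Finset.single_le_sum (f := fun k => |B k|) (fun _ _ => abs_nonneg _)
      (Finset.mem_range.2 h)
    change |B n| ≤ _ at this
    linarith [hB n i, le_abs_self (B n)]

/-- One sweep of the contraction: an asymptotic bound `c` of the errors improves to `β * c`, up to
any `ε`. Adding to the error the tail of its convergent noise series removes the noise from the
recursion. -/
theorem eventually_abs_le_of_noisy_averaging {a e f w : ℕ → ℝ} {b l : ℝ}
    (ha : ∀ n, 0 ≤ a n) (ha0 : Tendsto a atTop (𝓝 0)) (hs : ¬ Summable a)
    (he : ∀ n, e (n + 1) = (1 - a n) * e n + a n * (f n + w n))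
    (hw : Tendsto (fun n => ∑ k ∈ Finset.range n, a k * w k) atTop (𝓝 l))
    (hf : ∀ᶠ n in atTop, |f n| ≤ b) {ε : ℝ} (hε : 0 < ε) :
    ∀ᶠ n in atTop, |e n| ≤ b + ε := by
  set r : ℕ → ℝ := fun n => l - ∑ k ∈ Finset.range n, a k * w k with hr
  have hr0 : ∀ᶠ n in atTop, |r n| ≤ ε / 3 := by
    have h1 : Tendsto (fun n => |r n|) atTop (𝓝 0) := by
      simpa [hr] using (hw.const_sub l).abs
    exact h1.eventually (ge_mem_nhds (by positivity))
  have hstep : ∀ᶠ n in atTop, |e (n + 1) + r (n + 1)| ≤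
      (1 - a n) * |e n + r n| + a n * (b + ε / 3) := by
    filter_upwards [hf, hr0, ha0.eventually (ge_mem_nhds zero_lt_one)] with n h1 h2 h3
    have h4 : e (n + 1) + r (n + 1) = (1 - a n) * (e n + r n) + a n * (f n + r n) := by
      simp only [hr, he, Finset.sum_range_succ]
      ring
    rw [h4]
    refine (abs_add_le _ _).trans ?_
    rw [abs_mul, abs_mul, abs_of_nonneg (sub_nonneg.2 h3), abs_of_nonneg (ha n)]
    have := mul_le_mul_of_nonneg_left ((abs_add_le (f n) (r n)).trans (add_le_add h1 h2)) (ha n)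
    linarith
  have hy := eventually_le_of_averaging (u := fun n => |e n + r n|) ha ha0 hs hstep
    (ε := ε / 3) (by positivity)
  filter_upwards [hy, hr0] with n h1 h2
  have : |e n| ≤ |e n + r n| + |r n| := by
    have := abs_sub (e n + r n) (r n)
    rwa [add_sub_cancel_right] at this
  linarith

/-- Bounded errors which are asynchronously averaged towards a contraction of themselves, with
noise of convergent weighted sums, vanish in the limit. -/
theorem tendsto_zero_of_asynchronous_contraction {a e f w : ℕ → ι → ℝ} {β : ℝ} (hβ : β < 1)
    (hβ0 : 0 ≤ β) (ha : ∀ n i, 0 ≤ a n i) (ha0 : ∀ i, Tendsto (fun n => a n i) atTop (𝓝 0))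
    (hs : ∀ i, ¬ Summable fun n => a n i)
    (he : ∀ n i, e (n + 1) i = (1 - a n i) * e n i + a n i * (f n i + w n i))
    (hw : ∀ i, ∃ l, Tendsto (fun n => ∑ k ∈ Finset.range n, a k i * w k i) atTop (𝓝 l))
    (hf : ∀ n c, 0 ≤ c → (∀ j, |e n j| ≤ c) → ∀ i, |f n i| ≤ β * c)
    (hbdd : ∃ C, ∀ n i, |e n i| ≤ C) (i : ι) :
    Tendsto (fun n => e n i) atTop (𝓝 0) := by
  obtain ⟨C, hC⟩ := hbdd
  have hC' : 0 < |C| + 1 := by positivity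
  have hθ0 : 0 < (1 + β) / 2 := by linarith
  have hiter : ∀ k : ℕ, ∀ᶠ n in atTop, ∀ j, |e n j| ≤ ((1 + β) / 2) ^ k * (|C| + 1) := by
    intro k
    induction k with
    | zero =>
      refine Eventually.of_forall fun n j => ?_
      rw [pow_zero, one_mul]
      linarith [hC n j, le_abs_self C]
    | succ k ih =>
      refine eventually_all.2 fun j => ?_
      obtain ⟨l, hl⟩ := hw j
      set c := ((1 + β) / 2) ^ k * (|C| + 1) with hc
      have hc0 : 0 < c := by positivity
      have := eventually_abs_le_of_noisy_averaging (e := fun n => e n j)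
        (fun n => ha n j) (ha0 j) (hs j) (fun n => he n j) hl
        (ih.mono fun n hn => hf n c hc0.le hn j)
        (ε := (1 - β) / 2 * c) (mul_pos (by linarith) hc0)
      refine this.mono fun n hn => hn.trans (le_of_eq ?_)
      rw [pow_succ, hc]
      ring
  have hlim : Tendsto (fun k : ℕ => ((1 + β) / 2) ^ k * (|C| + 1)) atTop (𝓝 0) := by
    simpa using (tendsto_pow_atTop_nhds_zero_of_lt_one hθ0.le (by linarith)).mul_const (|C| + 1)
  refine Metric.tendsto_nhds.2 fun ε hε => ?_
  obtain ⟨k, hk⟩ := (hlim.eventually (gt_mem_nhds hε)).exists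
  filter_upwards [hiter k] with n hn
  rw [Real.dist_eq, sub_zero]
  exact (hn i).trans_lt hk

end Asynchronous


/-! ### The optimal values and the winning region -/

namespace SDES

variable {S E : Type*} [Fintype S] [Fintype E]

theorem P_pos_of_mem {D : SDES S E} {s x : S} {ξ : Finset E} {e : E} (hξ : ξ ∈ D.dir s)
    (he : e ∈ ξ) (hx : 0 < D.PT s e x) : 0 < D.P s ξ x := by
  have hP := isControlPattern_of_mem_dir hξ
  exact Finset.sum_pos' (fun e he => mul_nonneg (D.PE_pos s ξ hP e he).le (D.PT_nonneg s e x))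
    ⟨e, he, mul_pos (D.PE_pos s ξ hP e he) hx⟩

omit [Fintype E] in
theorem exists_PT_pos {D : SDES S E} {s x : S} {ξ : Finset E} (h : 0 < D.P s ξ x) :
    ∃ e ∈ ξ, 0 < D.PT s e x := by
  obtain ⟨e, he, hne⟩ := Finset.exists_ne_zero_of_sum_ne_zero h.ne'
  exact ⟨e, he, (D.PT_nonneg s e x).lt_of_ne' (right_ne_zero_of_mul hne)⟩

omit [Fintype E] in
theorem enabled_of_PT_pos {D : SDES S E} {s x : S} {e : E} (h : 0 < D.PT s e x) :
    ∑ x, D.PT s e x = 1 :=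
  (D.PT_sum s e).resolve_left
    (Finset.sum_pos' (fun x _ => D.PT_nonneg s e x) ⟨x, Finset.mem_univ x, h⟩).ne'

theorem mem_zeroDir {D : SDES S E} {Q : S → Finset E → ℝ} {s : S} {ξ : Finset E} :
    ξ ∈ D.zeroDir Q s ↔ ξ ∈ D.dir s ∧ Q s ξ = 0 :=
  Finset.mem_filter

theorem mem_estWin {D : SDES S E} {Q : S → Finset E → ℝ} {s : S} :
    s ∈ D.estWin Q ↔ ∃ ξ ∈ D.dir s, Q s ξ = 0 :=
  exists_congr fun _ => mem_zeroDir

section Values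

variable [MeasurableSpace S] [DiscreteMeasurableSpace S]
variable (D : SDES S E) (acc : Set S) (p : RewardParams) (hne : ∀ s, (D.dir s).Nonempty)
include hne

theorem maxDir_QStar_nonpos (s : S) : D.maxDir (D.QStar acc p) s ≤ 0 := by
  refine nonpos_of_contraction (A := Set.univ) p.maxDiscount_lt_one (fun c hc h s _ => ?_) s
    (Set.mem_univ s)
  refine D.maxDir_le _ (hne s) fun ξ hξ => ?_
  have hP := isControlPattern_of_mem_dir hξ
  rw [D.QStar_eq_backup acc p hne hξ]
  calc _ ≤ ∑ x, D.P s ξ x * (p.maxDiscount * c) := by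
        refine Finset.sum_le_sum fun x _ => mul_le_mul_of_nonneg_left ?_ (D.P_nonneg hP x)
        have h1 := p.reward_nonpos acc x
        have h2 := mul_le_mul_of_nonneg_left (h x (Set.mem_univ x)) (p.discount_pos acc x).le
        have h3 := mul_le_mul_of_nonneg_right (p.discount_le acc x) hc
        linarith
    _ = _ := by rw [← Finset.sum_mul, D.P_sum hP, one_mul]

theorem QStar_nonpos {s : S} {ξ : Finset E} (hξ : ξ ∈ D.dir s) : D.QStar acc p s ξ ≤ 0 :=
  (D.le_maxDir _ hξ).trans (D.maxDir_QStar_nonpos acc p hne s)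

/-- A state-pattern pair is losing if it may lead to a losing state. -/
theorem QStar_neg_of_succ {s x : S} {ξ : Finset E} (hξ : ξ ∈ D.dir s) (hx : 0 < D.P s ξ x)
    (hv : D.maxDir (D.QStar acc p) x < 0) : D.QStar acc p s ξ < 0 := by
  have hP := isControlPattern_of_mem_dir hξ
  rw [D.QStar_eq_backup acc p hne hξ]
  refine Finset.sum_neg' (fun y _ => ?_) ⟨x, Finset.mem_univ x, ?_⟩
  · refine mul_nonpos_of_nonneg_of_nonpos (D.P_nonneg hP y) ?_
    have h1 := p.reward_nonpos acc y
    have h2 := mul_nonpos_of_nonneg_of_nonpos (p.discount_pos acc y).le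
      (D.maxDir_QStar_nonpos acc p hne y)
    linarith
  · refine mul_neg_of_pos_of_neg hx ?_
    have h1 := p.reward_nonpos acc x
    have h2 := mul_neg_of_pos_of_neg (p.discount_pos acc x) hv
    linarith

theorem maxDir_QStar_of_mem_acc (hsink : ∀ s ∈ acc, ∀ e x, 0 < D.PT s e x → x ∈ acc) {s : S}
    (hs : s ∈ acc) : D.maxDir (D.QStar acc p) s = p.rn := by
  have key := nonpos_of_contraction (A := acc)
    (d := fun s => |D.maxDir (D.QStar acc p) s - p.rn|) p.maxDiscount_lt_one
    (fun c hc h s hs => ?_) s hs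
  · exact sub_eq_zero.1 (abs_nonpos_iff.1 key)
  · obtain ⟨ξ, hξ, hmax⟩ := D.exists_maxDir_eq (D.QStar acc p) (hne s)
    have hsucc : ∀ x, 0 < D.P s ξ x → x ∈ acc := fun x hx => by
      obtain ⟨e, -, he⟩ := exists_PT_pos hx
      exact hsink s hs e x he
    have hrn : D.backup acc p (fun _ => p.rn) s ξ = p.rn := by
      have hP := isControlPattern_of_mem_dir hξ
      calc _ = ∑ x, D.P s ξ x * p.rn := by
            refine Finset.sum_congr rfl fun x _ => ?_
            rcases (D.P_nonneg hP x).eq_or_lt with h0 | h0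
            · rw [← h0, zero_mul, zero_mul]
            · rw [RewardParams.reward, RewardParams.discount, if_pos (hsucc x h0),
                if_pos (hsucc x h0)]
              ring
        _ = _ := by rw [← Finset.sum_mul, D.P_sum hP, one_mul]
    have := D.abs_backup_sub_le acc p (v := D.maxDir (D.QStar acc p)) (w := fun _ => p.rn) hξ
      fun x hx => h x (hsucc x hx)
    rw [hrn] at this
    rwa [hmax, D.QStar_eq_backup acc p hne hξ]

theorem QStar_of_mem_acc (hsink : ∀ s ∈ acc, ∀ e x, 0 < D.PT s e x → x ∈ acc) {s : S}
    (hs : s ∈ acc) {ξ : Finset E} (hξ : ξ ∈ D.dir s) : D.QStar acc p s ξ = p.rn := by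
  have hP := isControlPattern_of_mem_dir hξ
  rw [D.QStar_eq_backup acc p hne hξ]
  calc _ = ∑ x, D.P s ξ x * p.rn := by
        refine Finset.sum_congr rfl fun x _ => ?_
        rcases (D.P_nonneg hP x).eq_or_lt with h0 | h0
        · rw [← h0, zero_mul, zero_mul]
        · obtain ⟨e, -, he⟩ := exists_PT_pos h0
          have hx := hsink s hs e x he
          rw [RewardParams.reward, RewardParams.discount, if_pos hx, if_pos hx,
            D.maxDir_QStar_of_mem_acc acc p hne hsink hx]
          ring
    _ = _ := by rw [← Finset.sum_mul, D.P_sum hP, one_mul]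

/-- A safe set in which the system can be kept has optimal value zero: the return is collected only
on `acc`. -/
theorem QStar_eq_zero_of_closed {W : Set S} (hacc : ∀ s ∈ W, s ∉ acc)
    (hW : ∀ s ∈ W, ∃ ξ ∈ D.dir s, ∀ x, 0 < D.P s ξ x → x ∈ W) {s : S} {ξ : Finset E}
    (hξ : ξ ∈ D.dir s) (hs : ∀ x, 0 < D.P s ξ x → x ∈ W) : D.QStar acc p s ξ = 0 := by
  have hlow : ∀ c, 0 ≤ c → (∀ x ∈ W, -D.maxDir (D.QStar acc p) x ≤ c) → ∀ s, ∀ ξ ∈ D.dir s,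
      (∀ x, 0 < D.P s ξ x → x ∈ W) → -D.QStar acc p s ξ ≤ p.maxDiscount * c := by
    intro c hc h s ξ hξ hs
    have hP := isControlPattern_of_mem_dir hξ
    rw [D.QStar_eq_backup acc p hne hξ, backup, ← Finset.sum_neg_distrib]
    calc _ ≤ ∑ x, D.P s ξ x * (p.maxDiscount * c) := by
          refine Finset.sum_le_sum fun x _ => ?_
          rcases (D.P_nonneg hP x).eq_or_lt with h0 | h0
          · rw [← h0, zero_mul, zero_mul, neg_zero]
          · rw [← mul_neg]
            refine mul_le_mul_of_nonneg_left ?_ h0.le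
            rw [RewardParams.reward, if_neg (hacc x (hs x h0)), zero_add, ← mul_neg]
            have h2 := mul_le_mul_of_nonneg_left (h x (hs x h0)) (p.discount_pos acc x).le
            have h3 := mul_le_mul_of_nonneg_right (p.discount_le acc x) hc
            linarith
      _ = _ := by rw [← Finset.sum_mul, D.P_sum hP, one_mul]
  have hzero := nonpos_of_contraction (A := W) (d := fun s => -D.maxDir (D.QStar acc p) s)
    p.maxDiscount_lt_one (fun c hc h s hs => by
      obtain ⟨ξ, hξ, hsucc⟩ := hW s hs
      have := D.le_maxDir (D.QStar acc p) hξ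
      have := hlow c hc h s ξ hξ hsucc
      linarith)
  have := hlow 0 le_rfl hzero s ξ hξ hs
  have := D.QStar_nonpos acc p hne hξ
  linarith

end Values

end SDES


/-! ### Stage 1: the learned winning region -/

namespace SDES

variable {S E : Type*} [Fintype S] [Fintype E]

/-- The state-pattern pairs of value zero in a table. -/
def zeroPairs (D : SDES S E) (Q : S → Finset E → ℝ) : Finset (S × Finset E) :=
  Finset.univ.filter fun i => i.2 ∈ D.dir i.1 ∧ Q i.1 i.2 = 0

theorem mem_zeroPairs {D : SDES S E} {Q : S → Finset E → ℝ} {i : S × Finset E} :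
    i ∈ D.zeroPairs Q ↔ i.2 ∈ D.dir i.1 ∧ Q i.1 i.2 = 0 := by
  simp [zeroPairs]

theorem estWin_subset_of_zeroPairs_subset {D : SDES S E} {Q Q' : S → Finset E → ℝ}
    (h : D.zeroPairs Q ⊆ D.zeroPairs Q') : D.estWin Q ⊆ D.estWin Q' := fun s hs => by
  obtain ⟨ξ, hξ, h0⟩ := mem_estWin.1 hs
  exact mem_estWin.2 ⟨ξ, mem_zeroPairs.1 (h (mem_zeroPairs (i := (s, ξ)).2 ⟨hξ, h0⟩))⟩

section StageOne

variable [MeasurableSpace S] [DiscreteMeasurableSpace S]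

/-- A table is sound if it is nonpositive, has the value `rn` on `acc`, and is zero wherever the
optimal value is. -/
structure IsSound (D : SDES S E) (acc : Set S) (p : RewardParams) (Q : S → Finset E → ℝ) :
    Prop where
  nonpos : ∀ s, ∀ ξ ∈ D.dir s, Q s ξ ≤ 0
  eq_rn : ∀ s ∈ acc, ∀ ξ ∈ D.dir s, Q s ξ = p.rn
  eq_zero : ∀ s, ∀ ξ ∈ D.dir s, D.QStar acc p s ξ = 0 → Q s ξ = 0

/-- Outside the estimated winning region of a sound table, the optimal values are negative. -/
theorem IsSound.maxDir_neg {D : SDES S E} {acc : Set S} {p : RewardParams}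
    {Q : S → Finset E → ℝ} (hQ : D.IsSound acc p Q) (hne : ∀ s, (D.dir s).Nonempty) {s : S}
    (hs : s ∉ D.estWin Q) :
    D.maxDir Q s < 0 ∧ D.maxDir (D.QStar acc p) s < 0 := by
  have h : ∀ ξ ∈ D.dir s, Q s ξ ≠ 0 := fun ξ hξ h0 => hs (mem_estWin.2 ⟨ξ, hξ, h0⟩)
  constructor
  · obtain ⟨ξ, hξ, hmax⟩ := D.exists_maxDir_eq Q (hne s)
    rw [hmax]
    exact lt_of_le_of_ne (hQ.nonpos s ξ hξ) (h ξ hξ)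
  · obtain ⟨ξ, hξ, hmax⟩ := D.exists_maxDir_eq (D.QStar acc p) (hne s)
    rw [hmax]
    exact lt_of_le_of_ne (D.QStar_nonpos acc p hne hξ) fun h0 => h ξ hξ (hQ.eq_zero s ξ hξ h0)

theorem IsSound.notMem_acc {D : SDES S E} {acc : Set S} {p : RewardParams}
    {Q : S → Finset E → ℝ} (hQ : D.IsSound acc p Q) {s : S} (hs : s ∈ D.estWin Q) : s ∉ acc :=
  fun h => by
    obtain ⟨ξ, hξ, h0⟩ := mem_estWin.1 hs
    rw [hQ.eq_rn s h ξ hξ] at h0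
    exact p.rn_neg.ne h0

omit [MeasurableSpace S] [DiscreteMeasurableSpace S] in
/-- An uncontrollable event belongs to every control pattern, so the updated pairs are those which
are seen to lead out of the estimated winning region with positive probability. -/
theorem P_pos_of_updated {D : SDES S E} {s x : S} {ξ ξ₁ : Finset E} {e : E}
    (hξ : ξ ∈ D.dir s) (hpos : 0 < D.PE s ξ e * D.PT s e x) (hξ₁ : ξ₁ ∈ D.dir s)
    (h : e ∉ D.ctrl ∨ ξ₁ = ξ) : 0 < D.P s ξ₁ x := by
  have hP := isControlPattern_of_mem_dir hξ
  have hPT : 0 < D.PT s e x :=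
    (D.PT_nonneg s e x).lt_of_ne' (right_ne_zero_of_mul hpos.ne')
  rcases h with h | rfl
  · exact P_pos_of_mem hξ₁
      ((isControlPattern_of_mem_dir hξ₁).2.2 e (enabled_of_PT_pos hPT) h) hPT
  · refine P_pos_of_mem hξ₁ ?_ hPT
    by_contra he
    exact left_ne_zero_of_mul hpos.ne' (D.PE_zero s ξ₁ hP e he)

/-- The updated values are negative. -/
theorem IsSound.tdValue_neg {D : SDES S E} {acc : Set S} {p : RewardParams} {α : ℝ}
    (hα : α ∈ Set.Ioo (0 : ℝ) 1) {Q : S → Finset E → ℝ} (hQ : D.IsSound acc p Q)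
    (hne : ∀ s, (D.dir s).Nonempty) {s x : S} {ξ : Finset E} (hξ : ξ ∈ D.dir s)
    (hx : x ∉ D.estWin Q) : D.tdValue acc p α Q s ξ x < 0 := by
  have h1 := mul_nonpos_of_nonneg_of_nonpos (sub_nonneg.2 hα.2.le) (hQ.nonpos s ξ hξ)
  have h2 := mul_neg_of_pos_of_neg (p.discount_pos acc x) (hQ.maxDir_neg hne hx).1
  have h3 := p.reward_nonpos acc x
  have h4 := mul_neg_of_pos_of_neg hα.1 (add_neg_of_nonpos_of_neg h3 h2)
  exact add_neg_of_nonpos_of_neg h1 h4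

/-- The update of Stage 1 keeps a table sound, creates no zeros and removes one. -/
theorem IsSound.updateOne {D : SDES S E} {acc : Set S} {p : RewardParams} {α : ℝ}
    (hα : α ∈ Set.Ioo (0 : ℝ) 1) {Q : S → Finset E → ℝ} (hQ : D.IsSound acc p Q)
    (hne : ∀ s, (D.dir s).Nonempty) {s x : S} {ξ : Finset E} {e : E}
    (hξ : ξ ∈ D.zeroDir Q s) (hpos : 0 < D.PE s ξ e * D.PT s e x) (hx : x ∉ D.estWin Q) :
    D.IsSound acc p (D.updateOne acc p α Q s ξ e x) ∧
      D.zeroPairs (D.updateOne acc p α Q s ξ e x) ⊂ D.zeroPairs Q := by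
  obtain ⟨hdir, hzero⟩ := mem_zeroDir.1 hξ
  have hs : s ∈ D.estWin Q := ⟨ξ, hξ⟩
  refine ⟨⟨fun s₁ ξ₁ h₁ => ?_, fun s₁ hs₁ ξ₁ h₁ => ?_, fun s₁ ξ₁ h₁ h0 => ?_⟩, ?_⟩
  · unfold SDES.updateOne
    split_ifs with h
    · exact (hQ.tdValue_neg hα hne h.2.1 hx).le
    · exact hQ.nonpos s₁ ξ₁ h₁
  · have : s₁ ≠ s := fun h => hQ.notMem_acc hs (h ▸ hs₁)
    unfold SDES.updateOne
    rw [if_neg fun h => this h.1]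
    exact hQ.eq_rn s₁ hs₁ ξ₁ h₁
  · unfold SDES.updateOne
    split_ifs with h
    · obtain ⟨rfl, h2, h3⟩ := h
      exact absurd h0 (D.QStar_neg_of_succ acc p hne h2 (P_pos_of_updated hdir hpos h2 h3)
        (hQ.maxDir_neg hne hx).2).ne
    · exact hQ.eq_zero s₁ ξ₁ h₁ h0
  · refine (Finset.ssubset_iff_of_subset fun i hi => ?_).2 ⟨(s, ξ), ?_, fun hmem => ?_⟩
    · obtain ⟨h1, h2⟩ := mem_zeroPairs.1 hi
      refine mem_zeroPairs.2 ⟨h1, ?_⟩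
      unfold SDES.updateOne at h2
      split_ifs at h2 with h
      · exact absurd h2 (hQ.tdValue_neg hα hne h.2.1 hx).ne
      · exact h2
    · exact mem_zeroPairs.2 ⟨hdir, hzero⟩
    · have h2 := (mem_zeroPairs.1 hmem).2
      unfold SDES.updateOne at h2
      rw [if_pos ⟨rfl, hdir, Or.inr rfl⟩] at h2
      exact (hQ.tdValue_neg hα hne hdir hx).ne h2

variable {Ω : Type*} [mΩ : MeasurableSpace Ω] {μ : Measure Ω} [IsProbabilityMeasure μ]
variable {D : SDES S E} {acc : Set S} {p : RewardParams} {α : ℝ}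

omit [MeasurableSpace S] [DiscreteMeasurableSpace S] in
theorem StageOneRun.ae_observed (R : D.StageOneRun acc p α μ) :
    ∀ᵐ ω ∂μ, ∀ n, (D.estWin (R.Q n ω)).Nonempty →
      R.pattern n ω ∈ D.zeroDir (R.Q n ω) (R.state n ω) ∧
      0 < D.PE (R.state n ω) (R.pattern n ω) (R.event n ω) *
        D.PT (R.state n ω) (R.event n ω) (R.succ n ω) := by
  have h1 : ∀ᵐ ω ∂μ, ∀ n ξ e x, R.pattern n ω = ξ ∧ R.event n ω = e ∧ R.succ n ω = x →
      0 < (μ[({ω | R.pattern n ω = ξ ∧ R.event n ω = e ∧ R.succ n ω = x}.indicator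
        fun _ => (1 : ℝ)) | R.ℱ n]) ω := by
    simp only [ae_all_iff]
    exact fun n ξ e x => ae_condExp_indicator_pos (R.ℱ.le n) (R.ℱ.le _ _ (R.meas_obs n ξ e x))
  have h2 := ae_all_iff.2 fun n => ae_all_iff.2 fun ξ => ae_all_iff.2 fun e =>
    ae_all_iff.2 fun x => R.law n ξ e x
  filter_upwards [h1, h2] with ω h1 h2 n hn
  have h3 := h1 n _ _ _ ⟨rfl, rfl, rfl⟩
  rw [h2 n _ _ _ hn] at h3
  split_ifs at h3 with h
  · exact ⟨h, pos_of_mul_pos_right h3 (inv_nonneg.2 (Nat.cast_nonneg _))⟩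
  · exact absurd h3 (lt_irrefl _)

/-- The tables of Stage 1 are sound and eventually constant, and finally the estimated winning
region is not left any more. -/
theorem StageOneRun.ae_eventually_const (R : D.StageOneRun acc p α μ)
    (hα : α ∈ Set.Ioo (0 : ℝ) 1) (hne : ∀ s, (D.dir s).Nonempty)
    (hsink : ∀ s ∈ acc, ∀ e x, 0 < D.PT s e x → x ∈ acc) :
    ∀ᵐ ω ∂μ, ∃ N, D.IsSound acc p (R.Q N ω) ∧ R.learnedWin ω = D.estWin (R.Q N ω) ∧
      ∀ n ≥ N, R.Q n ω = R.Q N ω ∧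
        ((D.estWin (R.Q N ω)).Nonempty → R.succ n ω ∈ D.estWin (R.Q N ω)) := by
  filter_upwards [R.init, ae_all_iff.2 R.stay, ae_all_iff.2 R.leave, ae_all_iff.2 R.halt,
    R.ae_observed] with ω hinit hstay hleave hhalt hobs
  have hstep : ∀ n, D.IsSound acc p (R.Q n ω) →
      (R.Q (n + 1) ω = R.Q n ω ∧
        ((D.estWin (R.Q n ω)).Nonempty → R.succ n ω ∈ D.estWin (R.Q n ω))) ∨
      (D.IsSound acc p (R.Q (n + 1) ω) ∧ D.zeroPairs (R.Q (n + 1) ω) ⊂ D.zeroPairs (R.Q n ω)) := by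
    intro n hn
    by_cases hW : (D.estWin (R.Q n ω)).Nonempty
    · by_cases hs : R.succ n ω ∈ D.estWin (R.Q n ω)
      · exact Or.inl ⟨(hstay n hs).1, fun _ => hs⟩
      · obtain ⟨h1, h2⟩ := hobs n hW
        rw [hleave n hW hs]
        exact Or.inr (hn.updateOne hα hne h1 h2 hs)
    · exact Or.inl ⟨hhalt n hW, fun h => absurd h hW⟩
  have hsound : ∀ n, D.IsSound acc p (R.Q n ω) := by
    intro n
    induction n with
    | zero =>
      refine ⟨fun s ξ hξ => ?_, fun s hs ξ hξ => ?_, fun s ξ hξ h0 => ?_⟩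
      · rw [hinit s ξ hξ]
        split_ifs
        exacts [p.rn_neg.le, le_rfl]
      · rw [hinit s ξ hξ, if_pos hs]
      · rw [hinit s ξ hξ, if_neg fun hs => ?_]
        rw [D.QStar_of_mem_acc acc p hne hsink hs hξ] at h0
        exact p.rn_neg.ne h0
    | succ n ih =>
      rcases hstep n ih with h | h
      · rw [h.1]
        exact ih
      · exact h.1
  have hanti : Antitone fun n => D.zeroPairs (R.Q n ω) := antitone_nat_of_succ_le fun n => by
    rcases hstep n (hsound n) with h | h
    · rw [h.1]
    · exact h.2.subset
  obtain ⟨N, hN⟩ := WellFoundedLT.antitone_chain_condition hanti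
  have hN' : ∀ n, N ≤ n → D.zeroPairs (R.Q n ω) = D.zeroPairs (R.Q N ω) := fun n hn =>
    (hN n hn).symm
  have hkeep : ∀ n, N ≤ n → R.Q (n + 1) ω = R.Q n ω ∧
      ((D.estWin (R.Q n ω)).Nonempty → R.succ n ω ∈ D.estWin (R.Q n ω)) := fun n hn =>
    (hstep n (hsound n)).resolve_right fun h => h.2.ne
      ((hN' (n + 1) (by omega)).trans (hN' n hn).symm)
  have hconst : ∀ n, N ≤ n → R.Q n ω = R.Q N ω := fun n hn => by
    induction n, hn using Nat.le_induction with
    | base => rfl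
    | succ n hn ih => rw [(hkeep n hn).1, ih]
  refine ⟨N, hsound N, ?_, fun n hn => ⟨hconst n hn, ?_⟩⟩
  · refine subset_antisymm (Set.iInter_subset _ N) (Set.subset_iInter fun n => ?_)
    rcases le_total n N with h | h
    · exact estWin_subset_of_zeroPairs_subset (hanti h)
    · rw [hconst n h]
  · have := (hkeep n hn).2
    rwa [hconst n hn] at this

/-- Stage 1 finds the optimal zeros: every pair which keeps the value zero is drawn infinitely
often, with all its outcomes, so the learned winning region is closed under these pairs. In
particular the learned winning region is not random. -/
theorem StageOneRun.ae_learned (R : D.StageOneRun acc p α μ)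
    (hα : α ∈ Set.Ioo (0 : ℝ) 1) (hne : ∀ s, (D.dir s).Nonempty)
    (hsink : ∀ s ∈ acc, ∀ e x, 0 < D.PT s e x → x ∈ acc)
    (hvisit : ∀ᵐ ω ∂μ, ∀ s ∈ R.learnedWin ω, ∃ᶠ n in atTop, R.state n ω = s) :
    ∀ᵐ ω ∂μ, R.learnedWin ω = D.estWin (D.QStar acc p) ∧
      ∃ Q, (∀ᶠ n in atTop, R.Q n ω = Q) ∧ D.IsSound acc p Q ∧
        ∀ s, ∀ ξ ∈ D.dir s, (Q s ξ = 0 ↔ D.QStar acc p s ξ = 0) := by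
  have hBC : ∀ᵐ ω ∂μ, ∀ s ξ e x, ∀ c > 0,
      (∃ᶠ n in atTop, ω ∈ {ω | R.state n ω = s} ∧
        c ≤ (μ[({ω | R.pattern n ω = ξ ∧ R.event n ω = e ∧ R.succ n ω = x}.indicator
          fun _ => (1 : ℝ)) | R.ℱ n]) ω) →
      ∃ᶠ n in atTop, ω ∈ {ω | R.pattern n ω = ξ ∧ R.event n ω = e ∧ R.succ n ω = x} ∩
        {ω | R.state n ω = s} := by
    refine ae_all_iff.2 fun s => ae_all_iff.2 fun ξ => ae_all_iff.2 fun e =>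
      ae_all_iff.2 fun x => ?_
    exact ae_frequently_inter_of_frequently_le_condExp (fun n => R.meas_obs n ξ e x)
      fun n => R.meas_state n s
  have hlaw := ae_all_iff.2 fun n => ae_all_iff.2 fun ξ => ae_all_iff.2 fun e =>
    ae_all_iff.2 fun x => R.law n ξ e x
  filter_upwards [R.ae_eventually_const hα hne hsink, hvisit, hBC, hlaw]
    with ω ⟨N, hsound, hwin, hN⟩ hvisit hBC hlaw
  have hclosed : ∀ s, ∀ ξ ∈ D.dir s, R.Q N ω s ξ = 0 → ∀ x, 0 < D.P s ξ x →
      x ∈ D.estWin (R.Q N ω) := by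
    intro s ξ hξ h0 x hx
    obtain ⟨e, he, hPT⟩ := exists_PT_pos hx
    have hzero : ξ ∈ D.zeroDir (R.Q N ω) s := mem_zeroDir.2 ⟨hξ, h0⟩
    have hW : (D.estWin (R.Q N ω)).Nonempty := ⟨s, ξ, hzero⟩
    have hc : 0 < ((D.zeroDir (R.Q N ω) s).card : ℝ)⁻¹ * (D.PE s ξ e * D.PT s e x) :=
      mul_pos (inv_pos.2 (Nat.cast_pos.2 (Finset.card_pos.2 ⟨ξ, hzero⟩)))
        (mul_pos (D.PE_pos s ξ (isControlPattern_of_mem_dir hξ) e he) hPT)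
    have hs : s ∈ R.learnedWin ω := hwin ▸ ⟨ξ, hzero⟩
    -- After time `N`, the pair `(s, ξ)` with the outcome `(e, x)` has the same positive conditional
    -- probability at each visit of `s`.
    have hfreq := hBC s ξ e x _ hc
      (((hvisit s hs).and_eventually (eventually_ge_atTop N)).mono fun n hn => by
        obtain ⟨rfl, hn⟩ := hn
        refine ⟨rfl, ?_⟩
        have hQ := (hN n hn).1
        have := hlaw n ξ e x (by rwa [hQ])
        rw [hQ, if_pos hzero] at this
        exact this.ge)
    obtain ⟨n, ⟨⟨-, -, hsucc⟩, -⟩, hn⟩ := (hfreq.and_eventually (eventually_ge_atTop N)).exists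
    exact hsucc ▸ (hN n hn).2 hW
  have hiff : ∀ s, ∀ ξ ∈ D.dir s, (R.Q N ω s ξ = 0 ↔ D.QStar acc p s ξ = 0) := by
    intro s ξ hξ
    refine ⟨fun h0 => ?_, hsound.eq_zero s ξ hξ⟩
    refine D.QStar_eq_zero_of_closed acc p hne (W := D.estWin (R.Q N ω))
      (fun s hs => hsound.notMem_acc hs) (fun s hs => ?_) hξ (hclosed s ξ hξ h0)
    obtain ⟨ξ, hξ, h0⟩ := mem_estWin.1 hs
    exact ⟨ξ, hξ, hclosed s ξ hξ h0⟩
  refine ⟨?_, R.Q N ω, eventually_atTop.2 ⟨N, fun n hn => (hN n hn).1⟩, hsound, hiff⟩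
  rw [hwin]
  ext s
  rw [mem_estWin, mem_estWin]
  exact exists_congr fun ξ => and_congr_right fun hξ => hiff s ξ hξ

end StageOne

end SDES


/-! ### Stage 2: convergence of the values -/

namespace SDES

theorem measurable_maxDir {S E Ω : Type*} [Fintype S] [Fintype E] {m : MeasurableSpace Ω}
    {D : SDES S E} (hne : ∀ s, (D.dir s).Nonempty) {Q : Ω → S → Finset E → ℝ} (x : S)
    (hQ : ∀ ξ, Measurable fun ω => Q ω x ξ) : Measurable fun ω => D.maxDir (Q ω) x := by
  convert Finset.measurable_sup' (hne x) (f := fun ξ ω => Q ω x ξ) fun ξ _ => hQ ξ using 1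
  funext ω
  rw [Finset.sup'_apply, maxDir, Finset.sup'_eq_csSup_image]

variable {S E : Type*} [Fintype S] [Fintype E] [MeasurableSpace S] [DiscreteMeasurableSpace S]
variable {Ω : Type*} [mΩ : MeasurableSpace Ω] {μ : Measure Ω} [IsProbabilityMeasure μ]
variable {D : SDES S E} {acc : Set S} {p : RewardParams} {α₁ : ℝ}
variable {R : D.StageOneRun acc p α₁ μ} {S₀ : Set S}

omit [MeasurableSpace S] [DiscreteMeasurableSpace S] in
theorem ReachOutside.notMem {W S₀ : Set S} {s : S}
    (h : D.ReachOutside W S₀ s) : s ∉ W := by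
  cases h <;> assumption

/-- The step size used for the pair `(s, ξ)` at update `n`, which is zero if another pair is
updated. -/
def StageTwoRun.stepSize (R₂ : StageTwoRun R S₀) (s : S) (ξ : Finset E) (n : ℕ) (ω : Ω) : ℝ :=
  if R₂.state n ω = s ∧ R₂.pattern n ω = ξ then R₂.α n ω else 0

/-- The target `R(x) + Γ(x) max_ξ Q(x, ξ)` of an update with next state `x`. -/
def target (D : SDES S E) (acc : Set S) (p : RewardParams) (Q : S → Finset E → ℝ) (x : S) : ℝ :=
  p.reward acc x + p.discount acc x * D.maxDir Q x

omit [MeasurableSpace S] [DiscreteMeasurableSpace S] [IsProbabilityMeasure μ] in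
theorem StageTwoRun.measurable_stepSize (R₂ : StageTwoRun R S₀) (s : S) (ξ : Finset E) (n : ℕ) :
    Measurable[R₂.ℱ n] (R₂.stepSize s ξ n) :=
  Measurable.ite (MeasurableSet.inter (R₂.meas_state n s) (R₂.meas_pattern n ξ))
    (R₂.meas_α n) measurable_const

omit [MeasurableSpace S] [DiscreteMeasurableSpace S] [IsProbabilityMeasure μ] in
theorem StageTwoRun.measurable_target (R₂ : StageTwoRun R S₀) (hne : ∀ s, (D.dir s).Nonempty)
    (x : S) (n : ℕ) : Measurable[R₂.ℱ n] fun ω => D.target acc p (R₂.Q n ω) x := by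
  have h : Measurable[R₂.ℱ n] fun ω => D.maxDir (R₂.Q n ω) x :=
    measurable_maxDir hne x fun ξ => R₂.meas_Q n x ξ
  exact (h.const_mul _).const_add _

omit [MeasurableSpace S] [DiscreteMeasurableSpace S] in
/-- The conditional law of the next state. -/
theorem StageTwoRun.ae_condExp_succ (R₂ : StageTwoRun R S₀) (n : ℕ) (x : S) :
    ∀ᵐ ω ∂μ, (μ[({ω | R₂.succ n ω = x}.indicator fun _ => (1 : ℝ)) | R₂.ℱ n]) ω =
      D.P (R₂.state n ω) (R₂.pattern n ω) x := by
  have hdecomp : ({ω | R₂.succ n ω = x}.indicator fun _ => (1 : ℝ)) =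
      ∑ e : E, {ω | R₂.event n ω = e ∧ R₂.succ n ω = x}.indicator fun _ => (1 : ℝ) := by
    funext ω
    simp only [Finset.sum_apply, Set.indicator_apply, Set.mem_ofPred_eq]
    by_cases h : R₂.succ n ω = x <;> simp [h]
  have hsum := condExp_finsetSum (μ := μ) (s := (Finset.univ : Finset E))
    (f := fun e => {ω | R₂.event n ω = e ∧ R₂.succ n ω = x}.indicator fun _ => (1 : ℝ))
    (fun e _ => (integrable_const (1 : ℝ)).indicator (R₂.ℱ.le _ _ (R₂.meas_obs n e x))) (R₂.ℱ n)
  rw [hdecomp]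
  filter_upwards [hsum, ae_all_iff.2 fun e => R₂.law n e x, R₂.pattern_mem n] with ω h1 h2 h3
  rw [h1, Finset.sum_apply]
  simp only [h2]
  have hP := isControlPattern_of_mem_dir h3
  refine (Finset.sum_subset (Finset.subset_univ _) fun e _ he => ?_).symm
  rw [D.PE_zero _ _ hP e he, zero_mul]

omit [MeasurableSpace S] [DiscreteMeasurableSpace S] [IsProbabilityMeasure μ] in
theorem StageTwoRun.measurableSet_succ (R₂ : StageTwoRun R S₀) (n : ℕ) (x : S) :
    MeasurableSet[R₂.ℱ (n + 1)] {ω | R₂.succ n ω = x} := by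
  have : {ω | R₂.succ n ω = x} = ⋃ e, {ω | R₂.event n ω = e ∧ R₂.succ n ω = x} := by
    ext ω
    simp
  rw [this]
  exact MeasurableSet.iUnion fun e => R₂.meas_obs n e x

omit [MeasurableSpace S] [DiscreteMeasurableSpace S] in
theorem StageTwoRun.ae_P_succ_pos (R₂ : StageTwoRun R S₀) :
    ∀ᵐ ω ∂μ, ∀ n, 0 < D.P (R₂.state n ω) (R₂.pattern n ω) (R₂.succ n ω) := by
  have h1 : ∀ᵐ ω ∂μ, ∀ n x, R₂.succ n ω = x →
      0 < (μ[({ω | R₂.succ n ω = x}.indicator fun _ => (1 : ℝ)) | R₂.ℱ n]) ω := by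
    simp only [ae_all_iff]
    exact fun n x => ae_condExp_indicator_pos (R₂.ℱ.le n)
      (R₂.ℱ.le _ _ (R₂.measurableSet_succ n x))
  filter_upwards [h1, ae_all_iff.2 fun n => ae_all_iff.2 fun x => R₂.ae_condExp_succ n x]
    with ω h1 h2 n
  rw [← h2]
  exact h1 n _ rfl

omit [MeasurableSpace S] [DiscreteMeasurableSpace S] in
/-- The weighted noise of the updates of a pair `(s, ξ)` has convergent sums, if the step sizes are
square-summable and the targets are bounded. The noise is a combination of the centred indicators
of the possible next states, with predictable weights. -/
theorem StageTwoRun.ae_tendsto_sum_noise (R₂ : StageTwoRun R S₀)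
    (hne : ∀ s, (D.dir s).Nonempty) :
    ∀ᵐ ω ∂μ, ∀ s ξ, Summable (fun n => R₂.stepSize s ξ n ω ^ 2) →
      (∃ C, ∀ n x, |D.target acc p (R₂.Q n ω) x| ≤ C) →
      ∃ l, Tendsto (fun n => ∑ k ∈ Finset.range n, R₂.stepSize s ξ k ω *
        (D.target acc p (R₂.Q k ω) (R₂.succ k ω) -
          D.backup acc p (D.maxDir (R₂.Q k ω)) s ξ)) atTop (𝓝 l) := by
  have hmart : ∀ᵐ ω ∂μ, ∀ s ξ x,
      Summable (fun n => (R₂.stepSize s ξ n ω * D.target acc p (R₂.Q n ω) x) ^ 2) →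
      ∃ l, Tendsto (fun n => ∑ k ∈ Finset.range n,
        R₂.stepSize s ξ k ω * D.target acc p (R₂.Q k ω) x *
          centredIndicator μ R₂.ℱ (fun n => {ω | R₂.succ n ω = x}) k ω) atTop (𝓝 l) := by
    refine ae_all_iff.2 fun s => ae_all_iff.2 fun ξ => ae_all_iff.2 fun x => ?_
    exact ae_tendsto_sum_of_summable_sq (fun n => R₂.measurableSet_succ n x)
      fun n => (R₂.measurable_stepSize s ξ n).mul (R₂.measurable_target hne x n)
  filter_upwards [hmart, ae_all_iff.2 fun n => ae_all_iff.2 fun x => R₂.ae_condExp_succ n x]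
    with ω hmart hcond s ξ hsum ⟨C, hC⟩
  have hx : ∀ x, Summable fun n => (R₂.stepSize s ξ n ω * D.target acc p (R₂.Q n ω) x) ^ 2 :=
    fun x => by
    refine Summable.of_nonneg_of_le (fun n => sq_nonneg _) (fun n => ?_) (hsum.mul_right (C ^ 2))
    rw [mul_pow]
    exact mul_le_mul_of_nonneg_left (sq_le_sq' (neg_le_of_abs_le (hC n x))
      (le_of_abs_le (hC n x))) (sq_nonneg _)
  choose l hl using fun x => hmart s ξ x (hx x)
  refine ⟨∑ x, l x, (tendsto_finsetSum Finset.univ fun x _ => hl x).congr fun n => ?_⟩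
  rw [Finset.sum_comm]
  refine Finset.sum_congr rfl fun k _ => ?_
  by_cases h : R₂.state k ω = s ∧ R₂.pattern k ω = ξ
  · have h1 : ∀ x, centredIndicator μ R₂.ℱ (fun n => {ω | R₂.succ n ω = x}) k ω =
        (if x = R₂.succ k ω then 1 else 0) - D.P s ξ x := fun x => by
      rw [centredIndicator, hcond, h.1, h.2]
      simp [Set.indicator_apply, eq_comm]
    simp only [h1, mul_assoc, ← Finset.mul_sum]
    congr 1
    simp only [mul_sub, Finset.sum_sub_distrib, mul_ite, mul_one, mul_zero, Finset.sum_ite_eq',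
      Finset.mem_univ, if_true, backup, target]
    exact congrArg _ (Finset.sum_congr rfl fun x _ => mul_comm _ _)
  · simp [stepSize, h]

omit [MeasurableSpace S] [DiscreteMeasurableSpace S] in
/-- All updates are made at states which are reachable outside the learned winning region. -/
theorem StageTwoRun.ae_reachOutside (R₂ : StageTwoRun R S₀) :
    ∀ᵐ ω ∂μ, ∀ n, D.ReachOutside (R.learnedWin ω) S₀ (R₂.state n ω) := by
  filter_upwards [R₂.start, ae_all_iff.2 R₂.state_notMem, ae_all_iff.2 R₂.pattern_mem,
    ae_all_iff.2 R₂.carryOn, ae_all_iff.2 R₂.restart, R₂.ae_P_succ_pos]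
    with ω hstart hnot hpat hcarry hrestart hpos n
  induction n with
  | zero => exact .base _ hstart (hnot 0)
  | succ n ih =>
    by_cases h : R₂.succ n ω ∈ R.learnedWin ω ∨ R₂.cut n ω
    · exact .base _ (hrestart n h) (hnot (n + 1))
    · obtain ⟨h1, h2⟩ := not_or.1 h
      rw [hcarry n h1 h2]
      exact .step _ _ _ ih (hpat n) (hpos n) h1

omit [MeasurableSpace S] [DiscreteMeasurableSpace S] [IsProbabilityMeasure μ] in
theorem StageTwoRun.update_apply (R₂ : StageTwoRun R S₀) {n : ℕ} {ω : Ω}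
    (h : R₂.Q (n + 1) ω = D.updateTwo acc p (R₂.α n ω) (R₂.Q n ω) (R₂.state n ω)
      (R₂.pattern n ω) (R₂.succ n ω)) (s : S) (ξ : Finset E) :
    R₂.Q (n + 1) ω s ξ = (1 - R₂.stepSize s ξ n ω) * R₂.Q n ω s ξ +
      R₂.stepSize s ξ n ω * D.target acc p (R₂.Q n ω) (R₂.succ n ω) := by
  rw [h, updateTwo, stepSize]
  by_cases h' : R₂.state n ω = s ∧ R₂.pattern n ω = ξ
  · obtain ⟨rfl, rfl⟩ := h'
    simp [tdValue, target]
  · rw [if_neg h', if_neg fun h => h' ⟨h.1.symm, h.2.symm⟩]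
    ring

omit [IsProbabilityMeasure μ] in
/-- Convergence along one path of Stage 2. Apart from the updated table entries at safe reachable
states, all entries which enter the targets have their optimal values from the beginning. -/
theorem StageTwoRun.tendsto_QStar_of_path (R₂ : StageTwoRun R S₀)
    (hne : ∀ s, (D.dir s).Nonempty) (hsink : ∀ s ∈ acc, ∀ e x, 0 < D.PT s e x → x ∈ acc)
    {ω : Ω} {W : Set S}
    (hα : ∀ s, D.ReachOutside W S₀ s → s ∉ acc → ∀ ξ ∈ D.dir s,
      ¬ Summable (fun n => R₂.stepSize s ξ n ω) ∧ Summable (fun n => R₂.stepSize s ξ n ω ^ 2))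
    (hupdate : ∀ n, R₂.Q (n + 1) ω = D.updateTwo acc p (R₂.α n ω) (R₂.Q n ω) (R₂.state n ω)
      (R₂.pattern n ω) (R₂.succ n ω))
    (hpos : ∀ n, 0 < D.P (R₂.state n ω) (R₂.pattern n ω) (R₂.succ n ω))
    (hconst : ∀ s, ¬ D.ReachOutside W S₀ s → ∀ n, R₂.Q n ω s = R₂.Q 0 ω s)
    (hacc : ∀ s ∈ acc, ∀ ξ ∈ D.dir s, ∀ n, R₂.Q n ω s ξ = p.rn)
    (hwin : ∀ s ∈ W, ∀ n, D.maxDir (R₂.Q n ω) s = D.maxDir (D.QStar acc p) s)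
    (hnoise : ∀ s ξ, Summable (fun n => R₂.stepSize s ξ n ω ^ 2) →
      (∃ C, ∀ n x, |D.target acc p (R₂.Q n ω) x| ≤ C) →
      ∃ l, Tendsto (fun n => ∑ k ∈ Finset.range n, R₂.stepSize s ξ k ω *
        (D.target acc p (R₂.Q k ω) (R₂.succ k ω) -
          D.backup acc p (D.maxDir (R₂.Q k ω)) s ξ)) atTop (𝓝 l))
    {s : S} (hs : D.ReachOutside W S₀ s) (hsacc : s ∉ acc) {ξ : Finset E} (hξ : ξ ∈ D.dir s) :
    Tendsto (fun n => R₂.Q n ω s ξ) atTop (𝓝 (D.QStar acc p s ξ)) := by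
  let ι := {i : S × Finset E // D.ReachOutside W S₀ i.1 ∧ i.1 ∉ acc ∧ i.2 ∈ D.dir i.1}
  let a : ℕ → ι → ℝ := fun n i => R₂.stepSize i.1.1 i.1.2 n ω
  let e : ℕ → ι → ℝ := fun n i => R₂.Q n ω i.1.1 i.1.2 - D.QStar acc p i.1.1 i.1.2
  have ha : ∀ n i, 0 ≤ a n i := fun n i => by
    simp only [a, stepSize]
    split_ifs
    exacts [R₂.α_nonneg n ω, le_rfl]
  have hsum : ∀ i : ι, ¬ Summable (fun n => a n i) ∧ Summable (fun n => a n i ^ 2) :=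
    fun i => hα _ i.2.1 i.2.2.1 _ i.2.2.2
  have ha0 : ∀ i, Tendsto (fun n => a n i) atTop (𝓝 0) := fun i => by
    have := (hsum i).2.tendsto_atTop_zero.sqrt
    simpa [Real.sqrt_sq (ha _ i)] using this
  have hV : ∀ n c, 0 ≤ c → (∀ j, |e n j| ≤ c) → ∀ x, (D.ReachOutside W S₀ x ∨ x ∈ W) →
      |D.maxDir (R₂.Q n ω) x - D.maxDir (D.QStar acc p) x| ≤ c := by
    intro n c hc h x hx
    by_cases hxacc : x ∈ acc
    · refine D.abs_maxDir_sub_le (hne x) fun ξ hξ => ?_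
      rw [hacc x hxacc ξ hξ n, D.QStar_of_mem_acc acc p hne hsink hxacc hξ, sub_self, abs_zero]
      exact hc
    · rcases hx with hx | hx
      · exact D.abs_maxDir_sub_le (hne x) fun ξ hξ => h ⟨(x, ξ), hx, hxacc, hξ⟩
      · rw [hwin x hx n, sub_self, abs_zero]
        exact hc
  have hsucc : ∀ i : ι, ∀ x, 0 < D.P i.1.1 i.1.2 x → D.ReachOutside W S₀ x ∨ x ∈ W :=
    fun i x hx => by
      by_cases h : x ∈ W
      · exact Or.inr h
      · exact Or.inl (.step _ _ _ i.2.1 i.2.2.2 hx h)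
  have hrec : ∀ n i, e (n + 1) i = (1 - a n i) * e n i +
      a n i * (D.target acc p (R₂.Q n ω) (R₂.succ n ω) - D.QStar acc p i.1.1 i.1.2) :=
    fun n i => by
      simp only [e, a, R₂.update_apply (hupdate n)]
      ring
  obtain ⟨M, hM⟩ : ∃ M, ∀ x, |D.maxDir (D.QStar acc p) x| ≤ M := by
    obtain ⟨M, hM⟩ := (Set.finite_range fun x => |D.maxDir (D.QStar acc p) x|).bddAbove
    exact ⟨M, fun x => hM ⟨x, rfl⟩⟩
  obtain ⟨M', hM'⟩ : ∃ M', ∀ i : ι, |D.QStar acc p i.1.1 i.1.2| ≤ M' := by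
    obtain ⟨M', hM'⟩ := (Set.finite_range fun i : ι => |D.QStar acc p i.1.1 i.1.2|).bddAbove
    exact ⟨M', fun i => hM' ⟨i, rfl⟩⟩
  have htarget : ∀ n c x, |D.maxDir (R₂.Q n ω) x| ≤ c →
      |D.target acc p (R₂.Q n ω) x| ≤ |p.rn| + p.maxDiscount * c := fun n c x h => by
    refine (abs_add_le _ _).trans (add_le_add (p.abs_reward_le acc x) ?_)
    rw [abs_mul, abs_of_pos (p.discount_pos acc x)]
    exact mul_le_mul (p.discount_le acc x) h (abs_nonneg _) p.maxDiscount_pos.le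
  have hVabs : ∀ n c, 0 ≤ c → (∀ j, |e n j| ≤ c) → ∀ x, (D.ReachOutside W S₀ x ∨ x ∈ W) →
      |D.maxDir (R₂.Q n ω) x| ≤ M + c := fun n c hc h x hx => by
    have h1 := hV n c hc h x hx
    have h2 := abs_add_le (D.maxDir (D.QStar acc p) x)
      (D.maxDir (R₂.Q n ω) x - D.maxDir (D.QStar acc p) x)
    rw [add_sub_cancel] at h2
    linarith [hM x]
  -- At updates of other pairs the step size vanishes, so the target may be replaced by zero there.
  obtain ⟨C, hC⟩ : ∃ C, ∀ n i, |e n i| ≤ C := by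
    refine exists_bound_of_averaging (a := a) (R := |p.rn| + p.maxDiscount * M + |M'|)
      (y := fun n i => if R₂.state n ω = i.1.1 ∧ R₂.pattern n ω = i.1.2 then
        D.target acc p (R₂.Q n ω) (R₂.succ n ω) - D.QStar acc p i.1.1 i.1.2 else 0)
      p.maxDiscount_lt_one ha ha0 (fun n i => ?_) fun n c hc h i => ?_
    · rw [hrec]
      split_ifs with h
      · rfl
      · simp [a, stepSize, h]
    · have hM0 : 0 ≤ M := (abs_nonneg _).trans (hM s)
      have h0 : 0 ≤ p.maxDiscount * M := mul_nonneg p.maxDiscount_pos.le hM0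
      have h1 : 0 ≤ p.maxDiscount * c := mul_nonneg p.maxDiscount_pos.le hc
      split_ifs with h'
      · have hx := hsucc i (R₂.succ n ω) (by rw [← h'.1, ← h'.2]; exact hpos n)
        have h2 := htarget n _ _ (hVabs n c hc h _ hx)
        have h3 := abs_sub (D.target acc p (R₂.Q n ω) (R₂.succ n ω)) (D.QStar acc p i.1.1 i.1.2)
        linarith [hM' i, le_abs_self M']
      · rw [abs_zero]
        positivity
  have hbdd : ∃ C, ∀ n x, |D.target acc p (R₂.Q n ω) x| ≤ C := by
    obtain ⟨B, hB⟩ := (Set.finite_range fun x => |D.maxDir (R₂.Q 0 ω) x|).bddAbove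
    refine ⟨|p.rn| + p.maxDiscount * (M + |C| + |B|), fun n x => htarget n _ x ?_⟩
    by_cases hx : D.ReachOutside W S₀ x ∨ x ∈ W
    · have := hVabs n |C| (abs_nonneg C) (fun j => (hC n j).trans (le_abs_self C)) x hx
      linarith [abs_nonneg B]
    · have h1 : D.maxDir (R₂.Q n ω) x = D.maxDir (R₂.Q 0 ω) x := by
        unfold maxDir
        rw [hconst x (fun h => hx (Or.inl h)) n]
      have h2 : |D.maxDir (R₂.Q 0 ω) x| ≤ B := hB ⟨x, rfl⟩
      rw [h1]
      linarith [le_abs_self B, abs_nonneg C, (abs_nonneg _).trans (hM s)]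
  have hlim := tendsto_zero_of_asynchronous_contraction (a := a) (e := e)
    (f := fun n i => D.backup acc p (D.maxDir (R₂.Q n ω)) i.1.1 i.1.2 -
      D.QStar acc p i.1.1 i.1.2)
    (w := fun n i => D.target acc p (R₂.Q n ω) (R₂.succ n ω) -
      D.backup acc p (D.maxDir (R₂.Q n ω)) i.1.1 i.1.2)
    p.maxDiscount_lt_one p.maxDiscount_pos.le ha ha0 (fun i => (hsum i).1)
    (fun n i => by rw [hrec]; ring) (fun i => hnoise _ _ (hsum i).2 hbdd)
    (fun n c hc h i => by
      rw [D.QStar_eq_backup acc p hne i.2.2.2]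
      exact D.abs_backup_sub_le acc p i.2.2.2 fun x hx => hV n c hc h x (hsucc i x hx))
    ⟨C, hC⟩ ⟨(s, ξ), hs, hsacc, hξ⟩
  simpa [e] using hlim.add_const (D.QStar acc p s ξ)

/-- Convergence of the two-stage learning on an arbitrary stochastic discrete event system whose
bad states form a sink. -/
theorem StageTwoRun.ae_tendsto_QStar (R₂ : StageTwoRun R S₀) (hα₁ : α₁ ∈ Set.Ioo (0 : ℝ) 1)
    (hne : ∀ s, (D.dir s).Nonempty) (hsink : ∀ s ∈ acc, ∀ e x, 0 < D.PT s e x → x ∈ acc)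
    (hvisit : ∀ᵐ ω ∂μ, ∀ s ∈ R.learnedWin ω, ∃ᶠ n in atTop, R.state n ω = s)
    (hα₂ : ∀ᵐ ω ∂μ, ∀ s, D.ReachOutside (R.learnedWin ω) S₀ s → s ∉ acc → ∀ ξ ∈ D.dir s,
      ¬ Summable ({n | R₂.state n ω = s ∧ R₂.pattern n ω = ξ}.indicator fun n => R₂.α n ω) ∧
      Summable ({n | R₂.state n ω = s ∧ R₂.pattern n ω = ξ}.indicator fun n => R₂.α n ω ^ 2)) :
    ∀ᵐ ω ∂μ,
      (∀ s, D.ReachOutside (R.learnedWin ω) S₀ s ∨ s ∈ acc → ∀ ξ ∈ D.dir s,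
        Tendsto (fun n => R₂.Q n ω s ξ) atTop (𝓝 (D.QStar acc p s ξ))) ∧
      ∀ s ∈ R.learnedWin ω,
        (∀ ξ ∈ D.dir s, D.QStar acc p s ξ = 0 →
          Tendsto (fun n => R₂.Q n ω s ξ) atTop (𝓝 (D.QStar acc p s ξ))) ∧
        Tendsto (fun n => D.maxDir (R₂.Q n ω) s) atTop (𝓝 (D.maxDir (D.QStar acc p) s)) := by
  filter_upwards [R.ae_learned hα₁ hne hsink hvisit, hα₂, R₂.init, R₂.ae_reachOutside,
    ae_all_iff.2 R₂.update, R₂.ae_P_succ_pos, R₂.ae_tendsto_sum_noise hne]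
    with ω ⟨hlearned, Q, hQ, hsound, hiff⟩ hα hinit hreach hupdate hpos hnoise
  have hQ0 : ∀ s, ∀ ξ ∈ D.dir s, R₂.Q 0 ω s ξ = Q s ξ := fun s ξ hξ =>
    tendsto_nhds_unique (hinit s ξ hξ)
      (tendsto_const_nhds.congr' (hQ.mono fun n hn => by simp only [hn]))
  have hconst : ∀ s, ¬ D.ReachOutside (R.learnedWin ω) S₀ s → ∀ n,
      R₂.Q n ω s = R₂.Q 0 ω s := fun s hs n => by
    induction n with
    | zero => rfl
    | succ n ih =>
      rw [← ih, hupdate]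
      funext ξ
      exact if_neg fun h : s = _ ∧ _ => hs (h.1 ▸ hreach n)
  have hacc : ∀ n, ∀ s ∈ acc, ∀ ξ ∈ D.dir s, R₂.Q n ω s ξ = p.rn := fun n => by
    induction n with
    | zero => exact fun s hs ξ hξ => (hQ0 s ξ hξ).trans (hsound.eq_rn s hs ξ hξ)
    | succ n ih =>
      intro s hs ξ hξ
      rw [hupdate, updateTwo]
      split_ifs with h
      · obtain ⟨rfl, rfl⟩ := h
        obtain ⟨e, -, he⟩ := exists_PT_pos (hpos n)
        have hx := hsink _ hs e _ he
        obtain ⟨ξ', hξ', hmax⟩ := D.exists_maxDir_eq (R₂.Q n ω) (hne (R₂.succ n ω))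
        rw [tdValue, hmax, ih _ hx ξ' hξ', ih _ hs _ hξ, RewardParams.reward,
          RewardParams.discount, if_pos hx, if_pos hx]
        ring
      · exact ih s hs ξ hξ
  have hwinQ : ∀ s ∈ R.learnedWin ω, ∀ n, ∀ ξ ∈ D.dir s, R₂.Q n ω s ξ = Q s ξ :=
    fun s hs n ξ hξ => by
      rw [hconst s (fun h => h.notMem hs) n, hQ0 s ξ hξ]
  have hwin : ∀ s ∈ R.learnedWin ω, ∀ n,
      D.maxDir (R₂.Q n ω) s = D.maxDir (D.QStar acc p) s := fun s hs n => by
    rw [D.maxDir_congr (hwinQ s hs n)]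
    rw [hlearned] at hs
    obtain ⟨ξ, hξ, h0⟩ := mem_estWin.1 hs
    have h1 : D.maxDir Q s = 0 := le_antisymm (D.maxDir_le Q (hne s) (hsound.nonpos s))
      (((hiff s ξ hξ).2 h0).symm.le.trans (D.le_maxDir Q hξ))
    have h2 : D.maxDir (D.QStar acc p) s = 0 :=
      le_antisymm (D.maxDir_QStar_nonpos acc p hne s) (h0.symm.le.trans (D.le_maxDir _ hξ))
    rw [h1, h2]
  have hstep : ∀ s ξ, (fun n => R₂.stepSize s ξ n ω) =
      {n | R₂.state n ω = s ∧ R₂.pattern n ω = ξ}.indicator fun n => R₂.α n ω := fun s ξ => by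
    funext n
    simp only [stepSize, Set.indicator_apply, Set.mem_ofPred_eq]
  have hstep2 : ∀ s ξ, (fun n => R₂.stepSize s ξ n ω ^ 2) =
      {n | R₂.state n ω = s ∧ R₂.pattern n ω = ξ}.indicator fun n => R₂.α n ω ^ 2 :=
    fun s ξ => by
      funext n
      simp only [stepSize, Set.indicator_apply, Set.mem_ofPred_eq]
      split_ifs <;> simp
  refine ⟨fun s hs ξ hξ => ?_, fun s hs => ⟨fun ξ hξ h0 => ?_, ?_⟩⟩
  · by_cases hsacc : s ∈ acc
    · rw [D.QStar_of_mem_acc acc p hne hsink hsacc hξ]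
      exact tendsto_const_nhds.congr fun n => (hacc n s hsacc ξ hξ).symm
    · refine R₂.tendsto_QStar_of_path hne hsink (W := R.learnedWin ω) (fun s hs hsacc ξ hξ => ?_)
        hupdate hpos hconst (fun s hs ξ hξ n => hacc n s hs ξ hξ) hwin hnoise
        (hs.resolve_right hsacc) hsacc hξ
      rw [hstep, hstep2]
      exact hα s hs hsacc ξ hξ
  · refine tendsto_const_nhds.congr fun n => ?_
    rw [hwinQ s hs n ξ hξ, h0, (hiff s ξ hξ).2 h0]
  · exact tendsto_const_nhds.congr fun n => (hwin s hs n).symm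

/-- Some directed control pattern exists wherever some event is enabled: the uncontrollable enabled
events if there are any, and a single controllable event otherwise. -/
theorem dir_nonempty {S E : Type*} [Fintype S] [Fintype E] (D : SDES S E) {s : S} {e : E}
    (he : D.Enabled s e) : (D.dir s).Nonempty := by
  by_cases h : ∃ e, D.Enabled s e ∧ e ∉ D.ctrl
  · obtain ⟨e', he', hc'⟩ := h
    refine ⟨Finset.univ.filter fun e => D.Enabled s e ∧ e ∉ D.ctrl,
      Finset.mem_filter.2 ⟨Finset.mem_univ _, ⟨⟨e', ?_⟩, fun e h => ?_, fun e h1 h2 => ?_⟩, ?_⟩⟩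
    · exact Finset.mem_filter.2 ⟨Finset.mem_univ _, he', hc'⟩
    · exact (Finset.mem_filter.1 h).2.1
    · exact Finset.mem_filter.2 ⟨Finset.mem_univ _, h1, h2⟩
    · rw [Finset.filter_filter, Finset.filter_false_of_mem fun e _ h => h.1.2 h.2]
      simp
  · refine ⟨{e}, Finset.mem_filter.2 ⟨Finset.mem_univ _, ⟨Finset.singleton_nonempty e,
      fun e' h => ?_, fun e' h1 h2 => absurd ⟨e', h1, h2⟩ h⟩, ?_⟩⟩
    · rw [Finset.mem_singleton.1 h]
      exact he
    · exact (Finset.card_filter_le _ _).trans (Finset.card_singleton e).le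

end SDES

theorem LabeledSDES.prod_dir_nonempty {S E AP X : Type*} [Fintype S] [Fintype E] [Fintype X]
    (D : LabeledSDES S E AP) (hD : ∀ s, ∃ e, D.Enabled s e) (B : OmegaAutomaton X (Set AP))
    (K : ℕ) (q : ProdState S X K) : ((D.prod B K).dir q).Nonempty := by
  obtain ⟨e, he⟩ := hD q.1
  exact (D.prod B K).dir_nonempty (e := e) ((D.prodPT_sum B K q e).trans he)

theorem LabeledSDES.prodAcc_sink {S E AP X : Type*} [Fintype S] [Fintype X]
    (D : LabeledSDES S E AP) (B : OmegaAutomaton X (Set AP)) (K : ℕ) (hK : B.DetAccIsSink K) :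
    ∀ q ∈ D.prodAcc B K, ∀ e q', 0 < (D.prod B K).PT q e q' → q' ∈ D.prodAcc B K := by
  intro q hq e q' hpos
  have h : q'.2 = B.detStep K q.2 (D.label q.1) := by
    by_contra h
    exact hpos.ne' (if_neg h)
  change q'.2 ∈ B.detAcc K
  rw [h]
  exact hK _ hq _

end

theorem mainTheorem8 {S E AP X Ω : Type*} [Fintype S] [Fintype E] [Fintype X]
    [MeasurableSpace Ω] (μ : Measure Ω) [IsProbabilityMeasure μ]
    (D : LabeledSDES S E AP) (hD : ∀ s, ∃ e, D.Enabled s e)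
    (φ : LTL AP) (B : OmegaAutomaton X (Set AP)) (hB : ∀ w, B.CoBuchiAccepts w ↔ φ.Sat w)
    (K : ℕ) (hK : B.DetAccIsSink K) (p : RewardParams)
    (α₁ : ℝ) (hα₁ : α₁ ∈ Set.Ioo (0 : ℝ) 1)
    (R₁ : (D.prod B K).StageOneRun (D.prodAcc B K) p α₁ μ)
    (hvisit : ∀ᵐ ω ∂μ, ∀ s ∈ R₁.learnedWin ω, ∃ᶠ n in atTop, R₁.state n ω = s)
    (S₀ : Set (ProdState S X K)) (R₂ : SDES.StageTwoRun R₁ S₀)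
    (hα₂ : ∀ᵐ ω ∂μ, ∀ s, (D.prod B K).ReachOutside (R₁.learnedWin ω) S₀ s → s ∉ D.prodAcc B K →
      ∀ ξ ∈ (D.prod B K).dir s,
        ¬ Summable ({n | R₂.state n ω = s ∧ R₂.pattern n ω = ξ}.indicator fun n => R₂.α n ω) ∧
        Summable ({n | R₂.state n ω = s ∧ R₂.pattern n ω = ξ}.indicator fun n => R₂.α n ω ^ 2)) :
    ∀ᵐ ω ∂μ,
      (∀ s, (D.prod B K).ReachOutside (R₁.learnedWin ω) S₀ s ∨ s ∈ D.prodAcc B K →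
        ∀ ξ ∈ (D.prod B K).dir s,
          Tendsto (fun n => R₂.Q n ω s ξ) atTop
            (𝓝 ((D.prod B K).QStar (D.prodAcc B K) p s ξ))) ∧
      ∀ s ∈ R₁.learnedWin ω,
        (∀ ξ ∈ (D.prod B K).dir s, (D.prod B K).QStar (D.prodAcc B K) p s ξ = 0 →
          Tendsto (fun n => R₂.Q n ω s ξ) atTop
            (𝓝 ((D.prod B K).QStar (D.prodAcc B K) p s ξ))) ∧
        Tendsto (fun n => (D.prod B K).maxDir (R₂.Q n ω) s) atTop
          (𝓝 ((D.prod B K).maxDir ((D.prod B K).QStar (D.prodAcc B K) p) s)) := by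
  exact R₂.ae_tendsto_QStar hα₁ (D.prod_dir_nonempty hD B K) (D.prodAcc_sink B K hK) hvisit hα₂
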